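/- Let $N\ge 3$, let $\Omega\subset\mathbb R^N$ be a bounded smooth domain, let $a:\Omega\to\mathbb R$ be measurable with $a>0$ a.e. in $\Omega$, and let $\gamma>0$, $p\ge 3$, $\lambda\ge 0$. Let $g:\mathbb R\to\mathbb R$ be the odd function with $g(0)=0$ and $g'(t)=(1+2g(t)^2)^{-1/2}$. Consider the problem $$(Q_\lambda)\qquad -\Delta v=\left[a(x)\,g(v)^{-\gamma}+\lambda\, g(v)^p\right]g'(v)\ \text{ in }\Omega,\qquad v>0\ \text{ in }\Omega,\qquad v=0\ \text{ on }\partial\Omega .$$ A function $v\in H^1_0(\Omega)\cap L^\infty(\Omega)$ with $v>0$ a.e. in $\Omega$ is called a solution of $(Q_\lambda)$ if for every $\psi\in H^1_0(\Omega)$ the functions $a\,g(v)^{-\gamma}g'(v)\psi$ and $g(v)^pg'(v)\psi$ belong to $L^1(\Omega)$ and $$\int_\Omega\nabla v\cdot\nabla\psi=\int_\Omega a\,g(v)^{-\gamma}g'(v)\psi+\lambda\int_\Omega g(v)^pg'(v)\psi .$$ It is called a subsolution (respectively a supersolution) if the same two integrability conditions hold, and the relation holds with $\le$ (respectively $\ge$)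 in place of $=$, for every $\psi\in H^1_0(\Omega)$ with $\psi\ge 0$ a.e. in $\Omega$. Let $\underline v$ be a subsolution and $\overline v$ a supersolution of $(Q_\lambda)$ with $\underline v\le\overline v$ a.e. in $\Omega$. Then there is a solution $v\in H^1_0(\Omega)\cap L^\infty(\Omega)$ of $(Q_\lambda)$ with $\underline v\le v\le\overline v$ a.e. in $\Omega$. Moreover, assume (H) there are $\varphi\in C^1_0(\overline\Omega)$ with $\varphi>0$ in $\Omega$ and $q\in(N,\infty)$ such that $a\varphi^{-\gamma}\in L^q(\Omega)$. Then $v$ can be chosen so that, in addition, $v\in D$ and $I_\lambda(v)=\min_{z\in D}I_\lambda(z)$, where $$I_\lambda(z)=\frac12\int_\Omega|\nabla z|^2-\int_\Omega a\,G(|z|)-\lambda\int_\Omega\tilde G(x,z),\qquad D=\Big\{z\in H^1_0(\Omega):\ \int_\Omega a\,G(|z|)\in\mathbb R\Big\}.$$ Here, for $t>0$, $G(t)=\ln g(t)$ if $\gamma=1$ and $G(t)=g(t)^{1-\gamma}/(1-\gamma)$ if $\gamma\ne1$, while $G(0)=0$ if $\gamma<1$ and $G(0)=-\infty$ if $\gamma\ge1$;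 further $\tilde G(x,t)=\int_0^t\tilde g(x,s)\,ds$, where $\tilde g(x,t)$ equals $g(\underline v(x))^pg'(\underline v(x))$ for $t\le\underline v(x)$, equals $g(t)^pg'(t)$ for $\underline v(x)\le t\le\overline v(x)$, and equals $g(\overline v(x))^pg'(\overline v(x))$ for $t\ge\overline v(x)$. -/

import Mathlib

open MeasureTheory Set Filter Topology
open scoped ENNReal ContDiff Gradient

namespace SingQuasi

/-! ### The change of variables `g` -/

/-- The inverse of the change of variables: `s ↦ ∫₀ˢ √(1 + 2 τ²) dτ`. -/
noncomputable def gInv (s : ℝ) : ℝ := ∫ τ in (0 : ℝ)..s, Real.sqrt (1 + 2 * τ ^ 2)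

theorem hasDerivAt_gInv (s : ℝ) : HasDerivAt gInv (Real.sqrt (1 + 2 * s ^ 2)) s := by
  have hc : Continuous fun τ : ℝ => Real.sqrt (1 + 2 * τ ^ 2) := by fun_prop
  exact intervalIntegral.integral_hasDerivAt_right (hc.intervalIntegrable _ _)
    (hc.stronglyMeasurableAtFilter _ _) hc.continuousAt

theorem gInv_zero : gInv 0 = 0 := by simp [gInv]

theorem one_le_sqrt_aux (s : ℝ) : 1 ≤ Real.sqrt (1 + 2 * s ^ 2) :=
  Real.one_le_sqrt.2 (by nlinarith [sq_nonneg s])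

theorem strictMono_gInv : StrictMono gInv := by
  apply strictMono_of_deriv_pos
  intro s
  rw [(hasDerivAt_gInv s).deriv]
  linarith [one_le_sqrt_aux s]

theorem continuous_gInv : Continuous gInv :=
  continuous_iff_continuousAt.2 fun s => (hasDerivAt_gInv s).continuousAt

theorem monotone_gInv_sub : Monotone fun s => gInv s - s := by
  have hd : ∀ s, HasDerivAt (fun s => gInv s - s) (Real.sqrt (1 + 2 * s ^ 2) - 1) s :=
    fun s => (hasDerivAt_gInv s).sub (hasDerivAt_id s)
  apply monotone_of_deriv_nonneg (fun s => (hd s).differentiableAt)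
  intro s
  rw [(hd s).deriv]
  linarith [one_le_sqrt_aux s]

theorem surjective_gInv : Function.Surjective gInv := by
  apply continuous_gInv.surjective
  · refine tendsto_atTop_mono' atTop ?_ tendsto_id
    filter_upwards [eventually_ge_atTop 0] with s hs
    have := monotone_gInv_sub hs
    simp only [gInv_zero, id] at *
    linarith
  · refine tendsto_atBot_mono' atBot ?_ tendsto_id
    filter_upwards [eventually_le_atBot 0] with s hs
    have := monotone_gInv_sub hs
    simp only [gInv_zero, id] at *
    linarith

/-- The change of variables `g`: the odd solution of `g' = (1 + 2 g²)^(-1/2)`, `g 0 = 0`, built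
as the inverse of `gInv`; see `g_zero`, `hasDerivAt_g` and `g_neg`. -/
noncomputable def g : ℝ → ℝ :=
  (StrictMono.orderIsoOfSurjective gInv strictMono_gInv surjective_gInv).symm

theorem gInv_g (t : ℝ) : gInv (g t) = t :=
  (StrictMono.orderIsoOfSurjective gInv strictMono_gInv surjective_gInv).apply_symm_apply t

theorem g_gInv (t : ℝ) : g (gInv t) = t :=
  (StrictMono.orderIsoOfSurjective gInv strictMono_gInv surjective_gInv).symm_apply_apply t

theorem g_zero : g 0 = 0 := by
  have := g_gInv 0
  rwa [gInv_zero] at this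

theorem hasDerivAt_g (t : ℝ) : HasDerivAt g (1 / Real.sqrt (1 + 2 * g t ^ 2)) t := by
  rw [one_div]
  refine HasDerivAt.of_local_left_inverse ?_ (hasDerivAt_gInv (g t)) ?_
    (Eventually.of_forall gInv_g)
  · exact (OrderIso.continuous _).continuousAt
  · linarith [one_le_sqrt_aux (g t)]

theorem g_neg (t : ℝ) : g (-t) = -g t := by
  apply strictMono_gInv.injective
  have h : ∀ s, gInv (-s) = -gInv s := by
    intro s
    have := intervalIntegral.integral_comp_neg
      (f := fun τ : ℝ => Real.sqrt (1 + 2 * τ ^ 2)) (a := 0) (b := s)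
    simp only [neg_sq, neg_zero] at this
    rw [gInv, gInv, intervalIntegral.integral_symm, ← this]
  rw [h, gInv_g, gInv_g]

/-! ### Domains and Sobolev spaces

Functions on `Ω` are represented by functions on the whole space, of which only the values in `Ω`
matter. -/

/-- A bounded smooth domain: open, connected, nonempty, bounded, and locally near each boundary
point the sublevel set `{ρ < 0}` of a smooth function `ρ` with nonvanishing differential. -/
structure IsBoundedSmoothDomain {N : ℕ} (Ω : Set (EuclideanSpace ℝ (Fin N))) : Prop where
  isOpen : IsOpen Ω
  isConnected : IsConnected Ω
  isBounded : Bornology.IsBounded Ω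
  smooth_boundary : ∀ x ∈ frontier Ω, ∃ U ∈ 𝓝 x, ∃ ρ : EuclideanSpace ℝ (Fin N) → ℝ,
    ContDiff ℝ ∞ ρ ∧ fderiv ℝ ρ x ≠ 0 ∧ ∀ y ∈ U, (y ∈ Ω ↔ ρ y < 0)

/-- Test functions: `φ ∈ C_c^∞(Ω)`. -/
def IsTestFunction {N : ℕ} (Ω : Set (EuclideanSpace ℝ (Fin N)))
    (φ : EuclideanSpace ℝ (Fin N) → ℝ) : Prop :=
  ContDiff ℝ ∞ φ ∧ HasCompactSupport φ ∧ tsupport φ ⊆ Ω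

/-- `F` is a weak gradient of `u` in `Ω` (for `u`, `F` locally integrable in `Ω`). -/
def IsWeakGrad {N : ℕ} (Ω : Set (EuclideanSpace ℝ (Fin N)))
    (u : EuclideanSpace ℝ (Fin N) → ℝ)
    (F : EuclideanSpace ℝ (Fin N) → EuclideanSpace ℝ (Fin N)) : Prop :=
  ∀ φ, IsTestFunction Ω φ → ∫ x in Ω, u x • ∇ φ x = -∫ x in Ω, φ x • F x

/-- `u ∈ H¹(Ω)`. -/
def MemH1 {N : ℕ} (Ω : Set (EuclideanSpace ℝ (Fin N)))
    (u : EuclideanSpace ℝ (Fin N) → ℝ) : Prop :=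
  MemLp u 2 (volume.restrict Ω) ∧ ∃ F : EuclideanSpace ℝ (Fin N) → EuclideanSpace ℝ (Fin N),
    MemLp F 2 (volume.restrict Ω) ∧ IsWeakGrad Ω u F

open Classical in
/-- The weak gradient in `L²(Ω)` of `u ∈ H¹(Ω)` (unique almost everywhere in `Ω`); `0` if
`u ∉ H¹(Ω)`. -/
noncomputable def wgrad {N : ℕ} (Ω : Set (EuclideanSpace ℝ (Fin N)))
    (u : EuclideanSpace ℝ (Fin N) → ℝ) :
    EuclideanSpace ℝ (Fin N) → EuclideanSpace ℝ (Fin N) :=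
  if h : MemH1 Ω u then h.2.choose else 0

/-- `u ∈ H¹₀(Ω)`, the closure of `C_c^∞(Ω)` in `H¹(Ω)`. -/
def MemH10 {N : ℕ} (Ω : Set (EuclideanSpace ℝ (Fin N)))
    (u : EuclideanSpace ℝ (Fin N) → ℝ) : Prop :=
  MemH1 Ω u ∧ ∃ φ : ℕ → EuclideanSpace ℝ (Fin N) → ℝ, (∀ n, IsTestFunction Ω (φ n)) ∧
    Tendsto (fun n => eLpNorm (fun x => φ n x - u x) 2 (volume.restrict Ω)) atTop (𝓝 0) ∧
    Tendsto (fun n => eLpNorm (fun x => ∇ (φ n) x - wgrad Ω u x) 2 (volume.restrict Ω))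
      atTop (𝓝 0)

/-- `φ ∈ C¹₀(Ω̄)`: `φ` is `C¹` in `Ω`, `φ` and its gradient extend continuously to the closure,
and `φ = 0` on the boundary. -/
def MemC10 {N : ℕ} (Ω : Set (EuclideanSpace ℝ (Fin N)))
    (φ : EuclideanSpace ℝ (Fin N) → ℝ) : Prop :=
  ContinuousOn φ (closure Ω) ∧ ContDiffOn ℝ 1 φ Ω ∧ (∀ x ∈ frontier Ω, φ x = 0) ∧
    ∃ F : EuclideanSpace ℝ (Fin N) → EuclideanSpace ℝ (Fin N),
      ContinuousOn F (closure Ω) ∧ ∀ x ∈ Ω, F x = ∇ φ x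

/-! ### The transformed problem

`-Δv = [a(x) g(v)^(-γ) + lam g(v)^p] g'(v)` in `Ω`, `v > 0` in `Ω`, `v = 0` on `∂Ω`. -/

/-- The weak solutions of the transformed problem. -/
structure IsSolution {N : ℕ} (Ω : Set (EuclideanSpace ℝ (Fin N)))
    (a : EuclideanSpace ℝ (Fin N) → ℝ) (γ p lam : ℝ)
    (v : EuclideanSpace ℝ (Fin N) → ℝ) : Prop where
  memH10 : MemH10 Ω v
  memLinfty : MemLp v ∞ (volume.restrict Ω)
  pos : ∀ᵐ x ∂(volume.restrict Ω), 0 < v x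
  integrable_sing : ∀ ψ, MemH10 Ω ψ →
    IntegrableOn (fun x => a x * g (v x) ^ (-γ) * deriv g (v x) * ψ x) Ω
  integrable_pow : ∀ ψ, MemH10 Ω ψ →
    IntegrableOn (fun x => g (v x) ^ p * deriv g (v x) * ψ x) Ω
  weak : ∀ ψ, MemH10 Ω ψ →
    ∫ x in Ω, inner ℝ (wgrad Ω v x) (wgrad Ω ψ x) =
      (∫ x in Ω, a x * g (v x) ^ (-γ) * deriv g (v x) * ψ x) +
        lam * ∫ x in Ω, g (v x) ^ p * deriv g (v x) * ψ x

/-- The subsolutions of the transformed problem. -/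
structure IsSubsolution {N : ℕ} (Ω : Set (EuclideanSpace ℝ (Fin N)))
    (a : EuclideanSpace ℝ (Fin N) → ℝ) (γ p lam : ℝ)
    (v : EuclideanSpace ℝ (Fin N) → ℝ) : Prop where
  memH10 : MemH10 Ω v
  memLinfty : MemLp v ∞ (volume.restrict Ω)
  pos : ∀ᵐ x ∂(volume.restrict Ω), 0 < v x
  integrable_sing : ∀ ψ, MemH10 Ω ψ → (∀ᵐ x ∂(volume.restrict Ω), 0 ≤ ψ x) →
    IntegrableOn (fun x => a x * g (v x) ^ (-γ) * deriv g (v x) * ψ x) Ω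
  integrable_pow : ∀ ψ, MemH10 Ω ψ → (∀ᵐ x ∂(volume.restrict Ω), 0 ≤ ψ x) →
    IntegrableOn (fun x => g (v x) ^ p * deriv g (v x) * ψ x) Ω
  weak : ∀ ψ, MemH10 Ω ψ → (∀ᵐ x ∂(volume.restrict Ω), 0 ≤ ψ x) →
    ∫ x in Ω, inner ℝ (wgrad Ω v x) (wgrad Ω ψ x) ≤
      (∫ x in Ω, a x * g (v x) ^ (-γ) * deriv g (v x) * ψ x) +
        lam * ∫ x in Ω, g (v x) ^ p * deriv g (v x) * ψ x

/-- The supersolutions of the transformed problem. -/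
structure IsSupersolution {N : ℕ} (Ω : Set (EuclideanSpace ℝ (Fin N)))
    (a : EuclideanSpace ℝ (Fin N) → ℝ) (γ p lam : ℝ)
    (v : EuclideanSpace ℝ (Fin N) → ℝ) : Prop where
  memH10 : MemH10 Ω v
  memLinfty : MemLp v ∞ (volume.restrict Ω)
  pos : ∀ᵐ x ∂(volume.restrict Ω), 0 < v x
  integrable_sing : ∀ ψ, MemH10 Ω ψ → (∀ᵐ x ∂(volume.restrict Ω), 0 ≤ ψ x) →
    IntegrableOn (fun x => a x * g (v x) ^ (-γ) * deriv g (v x) * ψ x) Ω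
  integrable_pow : ∀ ψ, MemH10 Ω ψ → (∀ᵐ x ∂(volume.restrict Ω), 0 ≤ ψ x) →
    IntegrableOn (fun x => g (v x) ^ p * deriv g (v x) * ψ x) Ω
  weak : ∀ ψ, MemH10 Ω ψ → (∀ᵐ x ∂(volume.restrict Ω), 0 ≤ ψ x) →
    (∫ x in Ω, a x * g (v x) ^ (-γ) * deriv g (v x) * ψ x) +
        lam * ∫ x in Ω, g (v x) ^ p * deriv g (v x) * ψ x ≤
      ∫ x in Ω, inner ℝ (wgrad Ω v x) (wgrad Ω ψ x)

/-- Hypothesis (H): there are `φ ∈ C¹₀(Ω̄)`, positive in `Ω`, and `q > N` with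
`a φ^(-γ) ∈ L^q(Ω)`. -/
def CondH {N : ℕ} (Ω : Set (EuclideanSpace ℝ (Fin N)))
    (a : EuclideanSpace ℝ (Fin N) → ℝ) (γ : ℝ) : Prop :=
  ∃ φ : EuclideanSpace ℝ (Fin N) → ℝ, ∃ q : ℝ, MemC10 Ω φ ∧ (N : ℝ) < q ∧
    (∀ x ∈ Ω, 0 < φ x) ∧
    MemLp (fun x => a x * φ x ^ (-γ)) (ENNReal.ofReal q) (volume.restrict Ω)

/-! ### The truncated singular energy -/

/-- The truncation `g̃(x, t)` of `g(t)^p g'(t)` between the values `lo = v̲(x)` and `hi = v̄(x)`. -/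
noncomputable def truncNonlin (p lo hi t : ℝ) : ℝ :=
  if t ≤ lo then g lo ^ p * deriv g lo
  else if t ≤ hi then g t ^ p * deriv g t
  else g hi ^ p * deriv g hi

/-- The primitive `G̃(x, t) = ∫₀ᵗ g̃(x, s) ds`. -/
noncomputable def truncPrim (p lo hi t : ℝ) : ℝ :=
  ∫ s in (0 : ℝ)..t, truncNonlin p lo hi s

/-- The primitive `G` of `g^(-γ) g'`, at `t > 0` and, if `γ < 1`, also at `t = 0`. For `γ ≥ 1`
it is infinite at `t = 0`; that value is excluded in `effDomain`. -/
noncomputable def singPrim (γ t : ℝ) : ℝ :=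
  if γ = 1 then Real.log (g t) else g t ^ (1 - γ) / (1 - γ)

/-- The effective domain `D = {v ∈ H¹₀(Ω) : ∫_Ω a G(|v|) ∈ ℝ}`. As `a > 0`, and `G` is infinite
at `0` if `γ ≥ 1`, finiteness of the integral includes `v ≠ 0` almost everywhere in that case. -/
def effDomain {N : ℕ} (Ω : Set (EuclideanSpace ℝ (Fin N)))
    (a : EuclideanSpace ℝ (Fin N) → ℝ) (γ : ℝ) : Set (EuclideanSpace ℝ (Fin N) → ℝ) :=
  {v | MemH10 Ω v ∧ (1 ≤ γ → ∀ᵐ x ∂(volume.restrict Ω), v x ≠ 0) ∧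
    IntegrableOn (fun x => a x * singPrim γ |v x|) Ω}

/-- The truncated energy `½ ∫_Ω |∇v|² - ∫_Ω a G(|v|) - lam ∫_Ω G̃(x, v)`. -/
noncomputable def truncEnergy {N : ℕ} (Ω : Set (EuclideanSpace ℝ (Fin N)))
    (a : EuclideanSpace ℝ (Fin N) → ℝ) (γ p lam : ℝ)
    (vlo vhi v : EuclideanSpace ℝ (Fin N) → ℝ) : ℝ :=
  1 / 2 * (∫ x in Ω, ‖wgrad Ω v x‖ ^ 2) - (∫ x in Ω, a x * singPrim γ |v x|) -
    lam * ∫ x in Ω, truncPrim p (vlo x) (vhi x) (v x)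

end SingQuasi

/-! The solution is a minimiser of an energy truncated between the ordered pair. Freeze the reaction
`a g^(-γ) g' + lam g^p g'` below `vlo` and above `vhi`, and let Φ be its primitive in t vanishing at
`vlo` (`reactionPrim`). Since `g^(-γ) g'` decreases on the positive axis, Φ is Lipschitz in t with
constant b = a g(vlo)^(-γ) g'(vlo) + lam M^p + 1, where M bounds `vhi`. The integrability required
of a subsolution makes b ψ integrable for every ψ in H¹₀. Hence J(u) = ½∫|∇u|² - ∫Φ(x,u) is finite
on H¹₀ despite the singularity.

Existence of a minimiser in the order interval K = [vlo, vhi] uses lattice structure in place of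
weak compactness. K is a lattice and J is submodular, so maxima of almost minimisers are again
almost minimisers. Choosing almost minimisers that also nearly maximise S(u) = ∫ b|u - vlo| gives a
sequence that is Cauchy in L¹ with weight b (`exists_minimizing_seq_of_submodular`). The width of K
is bounded, so the sequence is Cauchy in L²; the parallelogram identity makes the gradients Cauchy
too, and J passes to the strong limit (`exists_isMinOn_energy`).

Truncating any z in H¹₀ to K does not raise J: convexity of the Dirichlet integral is combined with
the supersolution inequality tested with (z - vhi)⁺ and the subsolution inequality tested with (vlo
- z)⁺ (`energy_clamp_le`). The minimiser over K therefore minimises over the linear space H¹₀.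
Variations in the directions ψ and -ψ give the weak equation, the truncation being inactive on K.

For the last claim, a G(vlo) is integrable: if γ ≠ 1, |G(t)| is at most a multiple of g^(-γ) g' t;
if γ = 1, the logarithm is controlled through the function φ of (H). On K the energies I and J then
differ by a constant. A competitor z in D is replaced by |z| and then truncated to K; neither step
raises I, since G is concave and so lies below its tangents at `vlo` and `vhi`. -/

namespace SingQuasi

/-! ### Sobolev functions with zero trace -/

/-! ### Convergence and products in L². -/

section L2

variable {α : Type*} [MeasurableSpace α] {μ : Measure α} {V : Type*} [NormedAddCommGroup V]

/-- Dominated convergence in `L²`. -/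
theorem tendsto_eLpNorm_two_of_dominated {f : ℕ → α → V} {f₀ : α → V} {b : α → ℝ}
    (hf : ∀ n, AEStronglyMeasurable (f n) μ) (hf₀ : AEStronglyMeasurable f₀ μ)
    (hb : MemLp b 2 μ) (hbound : ∀ n, ∀ᵐ x ∂μ, ‖f n x - f₀ x‖ ≤ b x)
    (hlim : ∀ᵐ x ∂μ, Tendsto (fun n => f n x) atTop (𝓝 (f₀ x))) :
    Tendsto (fun n => eLpNorm (fun x => f n x - f₀ x) 2 μ) atTop (𝓝 0) := by
  have key : Tendsto (fun n => ∫⁻ x, ‖f n x - f₀ x‖ₑ ^ (2 : ℝ) ∂μ) atTop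
      (𝓝 (∫⁻ _, 0 ∂μ)) := by
    refine tendsto_lintegral_of_dominated_convergence' (fun x => ‖b x‖ₑ ^ (2 : ℝ))
      (fun n => (((hf n).sub hf₀).enorm.pow_const _)) ?_ ?_ ?_
    · intro n
      filter_upwards [hbound n] with x hx
      gcongr
      exact enorm_le_iff_norm_le.2 (hx.trans (le_abs_self _))
    · have := hb.2
      rw [eLpNorm_lt_top_iff_lintegral_rpow_enorm_lt_top two_ne_zero ENNReal.ofNat_ne_top] at this
      exact this.ne
    · filter_upwards [hlim] with x hx
      have h1 : Tendsto (fun n => ‖f n x - f₀ x‖ₑ) atTop (𝓝 ‖f₀ x - f₀ x‖ₑ) :=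
        (continuous_enorm.tendsto _).comp (hx.sub_const _)
      rw [sub_self, enorm_zero] at h1
      have := ((ENNReal.continuous_rpow_const (y := 2)).tendsto 0).comp h1
      simpa [Function.comp_def] using this
  simp only [lintegral_zero] at key
  have := ((ENNReal.continuous_rpow_const (y := 1 / 2)).tendsto 0).comp key
  simp only [one_div, ENNReal.zero_rpow_of_pos (show (0 : ℝ) < 2⁻¹ by norm_num)] at this
  refine this.congr fun n => ?_
  simp [eLpNorm_eq_lintegral_rpow_enorm_toReal two_ne_zero ENNReal.ofNat_ne_top]

/-- Convergence in `L²` gives convergence almost everywhere along a subsequence. -/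
theorem exists_subseq_ae_of_tendsto_eLpNorm_two {f : ℕ → α → V} {f₀ : α → V}
    (hf : ∀ n, AEStronglyMeasurable (f n) μ) (hf₀ : AEStronglyMeasurable f₀ μ)
    (h : Tendsto (fun n => eLpNorm (fun x => f n x - f₀ x) 2 μ) atTop (𝓝 0)) :
    ∃ ns : ℕ → ℕ, StrictMono ns ∧
      ∀ᵐ x ∂μ, Tendsto (fun n => f (ns n) x) atTop (𝓝 (f₀ x)) :=
  (tendstoInMeasure_of_tendsto_eLpNorm two_ne_zero hf hf₀ h).exists_seq_tendsto_ae

theorem memLp_smul_const [NormedSpace ℝ V] {f : α → ℝ} {p : ℝ≥0∞} (hf : MemLp f p μ) (e : V) :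
    MemLp (fun x => f x • e) p μ :=
  (ContinuousLinearMap.toSpanSingleton ℝ e).comp_memLp' hf

theorem integrable_smul_of_memLp [NormedSpace ℝ V] {f : α → ℝ} {F : α → V} (hf : MemLp f 2 μ)
    (hF : MemLp F 2 μ) : Integrable (fun x => f x • F x) μ :=
  memLp_one_iff_integrable.1 (hF.smul hf)

theorem integrable_inner_of_memLp [InnerProductSpace ℝ V] {F G : α → V} (hF : MemLp F 2 μ)
    (hG : MemLp G 2 μ) : Integrable (fun x => inner ℝ (F x) (G x)) μ :=
  (L2.integrable_inner (𝕜 := ℝ) (hF.toLp F) (hG.toLp G)).congr <| by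
    filter_upwards [hF.coeFn_toLp, hG.coeFn_toLp] with x h1 h2
    rw [h1, h2]

end L2

variable {N : ℕ} {Ω : Set (EuclideanSpace ℝ (Fin N))}

/-! ### Test functions and their gradients. -/

section TestFunction

variable {φ ψ : EuclideanSpace ℝ (Fin N) → ℝ}

theorem continuous_gradient {n : WithTop ℕ∞} (hφ : ContDiff ℝ n φ) (hn : n ≠ 0) :
    Continuous (∇ φ) :=
  (LinearIsometryEquiv.continuous _).comp (hφ.continuous_fderiv hn)

theorem gradient_eq_zero_of_notMem_tsupport {x : EuclideanSpace ℝ (Fin N)}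
    (hx : x ∉ tsupport φ) : ∇ φ x = 0 := by
  have : fderiv ℝ φ x = 0 := by
    by_contra h
    exact hx (support_fderiv_subset ℝ h)
  simp [gradient, this]

theorem hasCompactSupport_gradient (hφ : HasCompactSupport φ) : HasCompactSupport (∇ φ) :=
  hφ.mono' fun x hx => by
    by_contra h
    exact hx (gradient_eq_zero_of_notMem_tsupport h)

theorem memLp_of_isTestFunction (hφ : IsTestFunction Ω φ) :
    MemLp φ 2 (volume.restrict Ω) :=
  (hφ.1.continuous.memLp_of_hasCompactSupport hφ.2.1).restrict Ω

theorem memLp_gradient_of_isTestFunction (hφ : IsTestFunction Ω φ) :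
    MemLp (∇ φ) 2 (volume.restrict Ω) :=
  ((continuous_gradient hφ.1 (by simp)).memLp_of_hasCompactSupport
    (hasCompactSupport_gradient hφ.2.1)).restrict Ω

theorem gradient_add_of_isTestFunction (hφ : IsTestFunction Ω φ) (hψ : IsTestFunction Ω ψ) :
    ∇ (φ + ψ) = ∇ φ + ∇ ψ := by
  ext1 x
  simp only [gradient, Pi.add_apply]
  rw [fderiv_add ((hφ.1.differentiable (by simp)) x) ((hψ.1.differentiable (by simp)) x), map_add]

theorem gradient_smul_of_isTestFunction (hφ : IsTestFunction Ω φ) (c : ℝ) :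
    ∇ (c • φ) = c • ∇ φ := by
  ext1 x
  simp only [gradient, Pi.smul_apply]
  rw [fderiv_const_smul ((hφ.1.differentiable (by simp)) x), map_smul]

theorem IsTestFunction.add (hφ : IsTestFunction Ω φ) (hψ : IsTestFunction Ω ψ) :
    IsTestFunction Ω (φ + ψ) :=
  ⟨hφ.1.add hψ.1, hφ.2.1.add hψ.2.1, (tsupport_add φ ψ).trans (union_subset hφ.2.2 hψ.2.2)⟩

theorem IsTestFunction.smul (hφ : IsTestFunction Ω φ) (c : ℝ) : IsTestFunction Ω (c • φ) :=
  ⟨hφ.1.const_smul c, hφ.2.1.smul_left (f := fun _ => c),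
    (closure_mono (Function.support_const_smul_subset c φ)).trans hφ.2.2⟩

theorem isTestFunction_zero : IsTestFunction Ω (0 : EuclideanSpace ℝ (Fin N) → ℝ) :=
  ⟨contDiff_const, HasCompactSupport.zero, by simp [tsupport]⟩

/-- Composition of a test function with a smooth function vanishing at `0`. -/
theorem IsTestFunction.comp_left (hφ : IsTestFunction Ω φ) {j : ℝ → ℝ} (hj : ContDiff ℝ ∞ j)
    (hj0 : j 0 = 0) : IsTestFunction Ω (fun x => j (φ x)) :=
  ⟨hj.comp hφ.1, hφ.2.1.comp_left hj0,
    (closure_mono (Function.support_comp_subset hj0 φ)).trans hφ.2.2⟩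

theorem gradient_comp_left (hφ : IsTestFunction Ω φ) {j : ℝ → ℝ} (hj : ContDiff ℝ ∞ j)
    (x : EuclideanSpace ℝ (Fin N)) : ∇ (fun x => j (φ x)) x = deriv j (φ x) • ∇ φ x := by
  have h1 : HasDerivAt j (deriv j (φ x)) (φ x) := ((hj.differentiable (by simp)) _).hasDerivAt
  have h2 := h1.comp_hasFDerivAt x ((hφ.1.differentiable (by simp)) x).hasFDerivAt
  have h3 : fderiv ℝ (fun x => j (φ x)) x = deriv j (φ x) • fderiv ℝ φ x := h2.fderiv
  simp only [gradient]
  rw [h3, map_smul]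

/-- Both integrands vanish off compact subsets of Ω, so the integrals may be taken over the whole
space, where integration by parts has no boundary term. Pairing with a fixed vector e reduces the
vector identity to directional derivatives. -/
theorem isWeakGrad_gradient (hφ : IsTestFunction Ω φ) : IsWeakGrad Ω φ (∇ φ) := by
  intro ψ hψ
  have e1 : ∫ x in Ω, φ x • ∇ ψ x = ∫ x, φ x • ∇ ψ x := by
    apply setIntegral_eq_integral_of_forall_compl_eq_zero
    intro x hx
    rw [gradient_eq_zero_of_notMem_tsupport fun h => hx (hψ.2.2 h), smul_zero]
  have e2 : ∫ x in Ω, ψ x • ∇ φ x = ∫ x, ψ x • ∇ φ x := by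
    apply setIntegral_eq_integral_of_forall_compl_eq_zero
    intro x hx
    rw [gradient_eq_zero_of_notMem_tsupport fun h => hx (hφ.2.2 h), smul_zero]
  rw [e1, e2]
  have i1 : Integrable (fun x => φ x • ∇ ψ x) :=
    (hφ.1.continuous.smul (continuous_gradient hψ.1 (by simp))).integrable_of_hasCompactSupport
      (hφ.2.1.smul_right)
  have i2 : Integrable (fun x => ψ x • ∇ φ x) :=
    (hψ.1.continuous.smul (continuous_gradient hφ.1 (by simp))).integrable_of_hasCompactSupport
      (hψ.2.1.smul_right)
  refine ext_inner_left ℝ fun e => ?_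
  rw [inner_neg_right, ← integral_inner i1, ← integral_inner i2]
  have := integral_mul_fderiv_eq_neg_fderiv_mul_of_integrable (μ := volume) (f := φ) (g := ψ)
    (v := e)
    (((hφ.1.continuous_fderiv (by simp)).clm_apply continuous_const).mul
      hψ.1.continuous |>.integrable_of_hasCompactSupport hψ.2.1.mul_left)
    (hφ.1.continuous.mul ((hψ.1.continuous_fderiv (by simp)).clm_apply continuous_const)
      |>.integrable_of_hasCompactSupport hφ.2.1.mul_right)
    (hφ.1.continuous.mul hψ.1.continuous |>.integrable_of_hasCompactSupport hφ.2.1.mul_right)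
    (fun x _ => (hφ.1.differentiable (by simp)) x) (fun x _ => (hψ.1.differentiable (by simp)) x)
  simp only [inner_smul_right, inner_gradient_right]
  simpa [mul_comm] using this

end TestFunction

/-! ### The closure of the test functions in H¹ and its weak gradients. -/

section Trace

/-- The pairs `(φ, ∇ φ)` of test functions in `L²(Ω) × L²(Ω; ℝᴺ)`. -/
noncomputable def testPairs (Ω : Set (EuclideanSpace ℝ (Fin N))) :
    Submodule ℝ (Lp ℝ 2 (volume.restrict Ω) ×
      Lp (EuclideanSpace ℝ (Fin N)) 2 (volume.restrict Ω)) where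
  carrier := {x | ∃ φ, ∃ h : IsTestFunction Ω φ,
    x = ((memLp_of_isTestFunction h).toLp φ, (memLp_gradient_of_isTestFunction h).toLp (∇ φ))}
  add_mem' := by
    rintro _ _ ⟨φ, hφ, rfl⟩ ⟨ψ, hψ, rfl⟩
    refine ⟨φ + ψ, hφ.add hψ, ?_⟩
    simp only [gradient_add_of_isTestFunction hφ hψ]
    rfl
  zero_mem' := by
    refine ⟨0, isTestFunction_zero, ?_⟩
    have : ∇ (0 : EuclideanSpace ℝ (Fin N) → ℝ) = 0 := by
      ext1 x
      simp [gradient]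
    simp only [this]
    rfl
  smul_mem' := by
    rintro c _ ⟨φ, hφ, rfl⟩
    refine ⟨c • φ, hφ.smul c, ?_⟩
    simp only [gradient_smul_of_isTestFunction hφ]
    rfl

/-- `u` is the limit in `L²(Ω)` of test functions whose gradients converge to `F` in `L²(Ω)`. -/
def IsH10Pair (Ω : Set (EuclideanSpace ℝ (Fin N))) (u : EuclideanSpace ℝ (Fin N) → ℝ)
    (F : EuclideanSpace ℝ (Fin N) → EuclideanSpace ℝ (Fin N)) : Prop :=
  ∃ (hu : MemLp u 2 (volume.restrict Ω)) (hF : MemLp F 2 (volume.restrict Ω)),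
    (hu.toLp u, hF.toLp F) ∈ (testPairs Ω).topologicalClosure

variable {u w : EuclideanSpace ℝ (Fin N) → ℝ}
  {F G : EuclideanSpace ℝ (Fin N) → EuclideanSpace ℝ (Fin N)}

theorem IsH10Pair.memLp (h : IsH10Pair Ω u F) : MemLp u 2 (volume.restrict Ω) := h.1

theorem IsH10Pair.memLp_grad (h : IsH10Pair Ω u F) : MemLp F 2 (volume.restrict Ω) := h.2.1

theorem IsH10Pair.add (hu : IsH10Pair Ω u F) (hw : IsH10Pair Ω w G) :
    IsH10Pair Ω (fun x => u x + w x) (fun x => F x + G x) :=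
  ⟨hu.1.add hw.1, hu.2.1.add hw.2.1, Submodule.add_mem _ hu.2.2 hw.2.2⟩

theorem IsH10Pair.const_mul (hu : IsH10Pair Ω u F) (c : ℝ) :
    IsH10Pair Ω (fun x => c * u x) (fun x => c • F x) :=
  ⟨hu.1.const_mul c, hu.2.1.const_smul c, Submodule.smul_mem _ c hu.2.2⟩

theorem IsH10Pair.sub (hu : IsH10Pair Ω u F) (hw : IsH10Pair Ω w G) :
    IsH10Pair Ω (fun x => u x - w x) (fun x => F x - G x) :=
  ⟨hu.1.sub hw.1, hu.2.1.sub hw.2.1, Submodule.sub_mem _ hu.2.2 hw.2.2⟩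

theorem IsH10Pair.congr_ae (hu : IsH10Pair Ω u F) (h : u =ᵐ[volume.restrict Ω] w)
    (h' : F =ᵐ[volume.restrict Ω] G) : IsH10Pair Ω w G := by
  obtain ⟨h1, h2, h3⟩ := hu
  refine ⟨h1.ae_eq h, h2.ae_eq h', ?_⟩
  rwa [← MemLp.toLp_congr h1 (h1.ae_eq h) h, ← MemLp.toLp_congr h2 (h2.ae_eq h') h']

theorem isH10Pair_of_isTestFunction {φ : EuclideanSpace ℝ (Fin N) → ℝ}
    (h : IsTestFunction Ω φ) : IsH10Pair Ω φ (∇ φ) :=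
  ⟨memLp_of_isTestFunction h, memLp_gradient_of_isTestFunction h,
    subset_closure ⟨φ, h, rfl⟩⟩

/-- Limits of pairs are pairs. -/
theorem isH10Pair_of_tendsto {un : ℕ → EuclideanSpace ℝ (Fin N) → ℝ}
    {Fn : ℕ → EuclideanSpace ℝ (Fin N) → EuclideanSpace ℝ (Fin N)}
    (h : ∀ n, IsH10Pair Ω (un n) (Fn n)) (hu : MemLp u 2 (volume.restrict Ω))
    (hF : MemLp F 2 (volume.restrict Ω))
    (h1 : Tendsto (fun n => eLpNorm (fun x => un n x - u x) 2 (volume.restrict Ω)) atTop (𝓝 0))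
    (h2 : Tendsto (fun n => eLpNorm (fun x => Fn n x - F x) 2 (volume.restrict Ω)) atTop (𝓝 0)) :
    IsH10Pair Ω u F := by
  refine ⟨hu, hF, ?_⟩
  have t1 := (Lp.tendsto_Lp_iff_tendsto_eLpNorm'' un (fun n => (h n).1) u hu).2 h1
  have t2 := (Lp.tendsto_Lp_iff_tendsto_eLpNorm'' Fn (fun n => (h n).2.1) F hF).2 h2
  exact (testPairs Ω).isClosed_topologicalClosure.mem_of_tendsto (t1.prodMk_nhds t2)
    (Eventually.of_forall fun n => (h n).2.2)

theorem IsH10Pair.exists_seq (h : IsH10Pair Ω u F) :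
    ∃ φ : ℕ → EuclideanSpace ℝ (Fin N) → ℝ, (∀ n, IsTestFunction Ω (φ n)) ∧
    Tendsto (fun n => eLpNorm (fun x => φ n x - u x) 2 (volume.restrict Ω)) atTop (𝓝 0) ∧
    Tendsto (fun n => eLpNorm (fun x => ∇ (φ n) x - F x) 2 (volume.restrict Ω)) atTop (𝓝 0) := by
  obtain ⟨hu, hF, hc⟩ := h
  obtain ⟨x, hx, hlim⟩ := mem_closure_iff_seq_limit.1 hc
  choose φ hφ hxφ using hx
  obtain rfl : x = _ := funext hxφ
  exact ⟨φ, hφ,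
    (Lp.tendsto_Lp_iff_tendsto_eLpNorm'' φ (fun n => memLp_of_isTestFunction (hφ n)) u hu).1
      ((continuous_fst.tendsto _).comp hlim),
    (Lp.tendsto_Lp_iff_tendsto_eLpNorm'' (fun n => ∇ (φ n))
      (fun n => memLp_gradient_of_isTestFunction (hφ n)) F hF).1
      ((continuous_snd.tendsto _).comp hlim)⟩

/-- Written as an inner product in L², the functional is visibly continuous in u, which is what the
passage to the closure in `IsH10Pair.isWeakGrad` needs. -/
theorem inner_integral_smul_gradient {ψ : EuclideanSpace ℝ (Fin N) → ℝ}
    (hψ : IsTestFunction Ω ψ) (hu : MemLp u 2 (volume.restrict Ω))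
    (e : EuclideanSpace ℝ (Fin N)) :
    inner ℝ e (∫ x in Ω, u x • ∇ ψ x) =
      inner ℝ (((memLp_gradient_of_isTestFunction hψ).const_inner e).toLp _) (hu.toLp u) := by
  rw [← integral_inner (integrable_smul_of_memLp hu (memLp_gradient_of_isTestFunction hψ)),
    L2.inner_def]
  apply integral_congr_ae
  filter_upwards [hu.coeFn_toLp,
    ((memLp_gradient_of_isTestFunction hψ).const_inner (𝕜 := ℝ) e).coeFn_toLp] with x h1 h2
  rw [h1, h2]
  simp [inner_smul_right]

theorem inner_integral_smul_vector {ψ : EuclideanSpace ℝ (Fin N) → ℝ}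
    (hψ : IsTestFunction Ω ψ) (hF : MemLp F 2 (volume.restrict Ω))
    (e : EuclideanSpace ℝ (Fin N)) :
    inner ℝ e (∫ x in Ω, ψ x • F x) =
      inner ℝ ((memLp_smul_const (memLp_of_isTestFunction hψ) e).toLp (fun x => ψ x • e))
        (hF.toLp F) := by
  rw [← integral_inner (integrable_smul_of_memLp (memLp_of_isTestFunction hψ) hF), L2.inner_def]
  apply integral_congr_ae
  filter_upwards [hF.coeFn_toLp,
    (memLp_smul_const (memLp_of_isTestFunction hψ) e).coeFn_toLp] with x h1 h2
  rw [h1, h2]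
  simp [inner_smul_right, inner_smul_left]

/-- For a fixed test function and a fixed vector, both sides are continuous in the pair (u, F), so
the identity is a closed condition and extends from test functions to their closure. -/
theorem IsH10Pair.isWeakGrad (h : IsH10Pair Ω u F) : IsWeakGrad Ω u F := by
  obtain ⟨hu, hF, hc⟩ := h
  intro ψ hψ
  refine ext_inner_left ℝ fun e => ?_
  rw [inner_neg_right, inner_integral_smul_gradient hψ hu, inner_integral_smul_vector hψ hF]
  have hcl : IsClosed {x : Lp ℝ 2 (volume.restrict Ω) ×
      Lp (EuclideanSpace ℝ (Fin N)) 2 (volume.restrict Ω) |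
      inner ℝ (((memLp_gradient_of_isTestFunction hψ).const_inner e).toLp _) x.1 =
      -inner ℝ ((memLp_smul_const (memLp_of_isTestFunction hψ) e).toLp (fun x => ψ x • e)) x.2} :=
    isClosed_eq (by fun_prop) (by fun_prop)
  refine closure_minimal ?_ hcl hc
  rintro _ ⟨φ, hφ, rfl⟩
  simp only [mem_ofPred_eq]
  rw [← inner_integral_smul_gradient hψ, ← inner_integral_smul_vector hψ,
    isWeakGrad_gradient hφ ψ hψ, inner_neg_right]

/-- Uniqueness of the weak gradient. -/
theorem IsWeakGrad.ae_eq (hΩ : IsOpen Ω) (hF : MemLp F 2 (volume.restrict Ω))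
    (hG : MemLp G 2 (volume.restrict Ω)) (h : IsWeakGrad Ω u F) (h' : IsWeakGrad Ω u G) :
    F =ᵐ[volume.restrict Ω] G := by
  rw [Filter.EventuallyEq, ae_restrict_iff' hΩ.measurableSet]
  have := hΩ.ae_eq_zero_of_integral_contDiff_smul_eq_zero (f := F - G) (μ := volume)
    (locallyIntegrableOn_of_locallyIntegrable_restrict
      ((hF.sub hG).locallyIntegrable (by norm_num))) ?_
  · filter_upwards [this] with x hx hxΩ
    exact sub_eq_zero.1 (hx hxΩ)
  intro φ h1 h2 h3
  have hφ : IsTestFunction Ω φ := ⟨h1, h2, h3⟩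
  rw [← setIntegral_eq_integral_of_forall_compl_eq_zero (s := Ω)]
  · simp only [Pi.sub_apply, smul_sub]
    rw [integral_sub (integrable_smul_of_memLp (memLp_of_isTestFunction hφ) hF)
      (integrable_smul_of_memLp (memLp_of_isTestFunction hφ) hG), sub_eq_zero, ← neg_inj,
      ← h φ hφ, h' φ hφ]
  · intro x hx
    rw [image_eq_zero_of_notMem_tsupport fun h => hx (h3 h), zero_smul]

theorem MemH1.memLp_wgrad (h : MemH1 Ω u) : MemLp (wgrad Ω u) 2 (volume.restrict Ω) := by
  rw [wgrad, dif_pos h]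
  exact h.2.choose_spec.1

theorem MemH1.isWeakGrad_wgrad (h : MemH1 Ω u) : IsWeakGrad Ω u (wgrad Ω u) := by
  rw [wgrad, dif_pos h]
  exact h.2.choose_spec.2

/-- The bridge between `wgrad`, which is an arbitrary choice, and the explicit gradient carried by a
pair. All later computations use pairs and return to `wgrad` through this. -/
theorem IsH10Pair.wgrad_ae_eq (hΩ : IsOpen Ω) (h : IsH10Pair Ω u F) :
    wgrad Ω u =ᵐ[volume.restrict Ω] F :=
  have h1 : MemH1 Ω u := ⟨h.1, F, h.2.1, h.isWeakGrad⟩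
  h1.isWeakGrad_wgrad.ae_eq hΩ h1.memLp_wgrad h.2.1 h.isWeakGrad

theorem IsH10Pair.ae_eq (hΩ : IsOpen Ω) (h : IsH10Pair Ω u F) (h' : IsH10Pair Ω u G) :
    F =ᵐ[volume.restrict Ω] G :=
  (h.wgrad_ae_eq hΩ).symm.trans (h'.wgrad_ae_eq hΩ)

theorem IsH10Pair.memH10 (hΩ : IsOpen Ω) (h : IsH10Pair Ω u F) : MemH10 Ω u := by
  obtain ⟨φ, hφ, t1, t2⟩ := h.exists_seq
  refine ⟨⟨h.1, F, h.2.1, h.isWeakGrad⟩, φ, hφ, t1, t2.congr fun n => ?_⟩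
  apply eLpNorm_congr_ae
  filter_upwards [h.wgrad_ae_eq hΩ] with x hx
  rw [hx]

theorem MemH10.isH10Pair (h : MemH10 Ω u) : IsH10Pair Ω u (wgrad Ω u) := by
  obtain ⟨h1, φ, hφ, t1, t2⟩ := h
  exact isH10Pair_of_tendsto (fun n => isH10Pair_of_isTestFunction (hφ n)) h1.1 h1.memLp_wgrad
    t1 t2

end Trace

/-! ### Chain rule, absolute value and positive part. -/

section Lattice

variable {u w : EuclideanSpace ℝ (Fin N) → ℝ}
  {F G : EuclideanSpace ℝ (Fin N) → EuclideanSpace ℝ (Fin N)}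

/-- Pairs are closed under dominated convergence. -/
theorem isH10Pair_of_dominated {un : ℕ → EuclideanSpace ℝ (Fin N) → ℝ}
    {Fn : ℕ → EuclideanSpace ℝ (Fin N) → EuclideanSpace ℝ (Fin N)}
    {b c : EuclideanSpace ℝ (Fin N) → ℝ}
    (h : ∀ n, IsH10Pair Ω (un n) (Fn n))
    (hb : MemLp b 2 (volume.restrict Ω)) (hc : MemLp c 2 (volume.restrict Ω))
    (hub : ∀ n, ∀ᵐ x ∂volume.restrict Ω, ‖un n x‖ ≤ b x)
    (hFc : ∀ n, ∀ᵐ x ∂volume.restrict Ω, ‖Fn n x‖ ≤ c x)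
    (hu : ∀ᵐ x ∂volume.restrict Ω, Tendsto (fun n => un n x) atTop (𝓝 (u x)))
    (hF : ∀ᵐ x ∂volume.restrict Ω, Tendsto (fun n => Fn n x) atTop (𝓝 (F x))) :
    IsH10Pair Ω u F := by
  have mu : AEStronglyMeasurable u (volume.restrict Ω) :=
    aestronglyMeasurable_of_tendsto_ae atTop (fun n => (h n).1.1) hu
  have mF : AEStronglyMeasurable F (volume.restrict Ω) :=
    aestronglyMeasurable_of_tendsto_ae atTop (fun n => (h n).2.1.1) hF
  have bu : ∀ᵐ x ∂volume.restrict Ω, ‖u x‖ ≤ b x := by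
    filter_upwards [ae_all_iff.2 hub, hu] with x h1 h2
    exact le_of_tendsto' h2.norm h1
  have bF : ∀ᵐ x ∂volume.restrict Ω, ‖F x‖ ≤ c x := by
    filter_upwards [ae_all_iff.2 hFc, hF] with x h1 h2
    exact le_of_tendsto' h2.norm h1
  refine isH10Pair_of_tendsto h (hb.mono' mu bu) (hc.mono' mF bF) ?_ ?_
  · refine tendsto_eLpNorm_two_of_dominated (fun n => (h n).1.1) mu (hb.add hb) (fun n => ?_) hu
    filter_upwards [hub n, bu] with x h1 h2
    exact (norm_sub_le _ _).trans (add_le_add h1 h2)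
  · refine tendsto_eLpNorm_two_of_dominated (fun n => (h n).2.1.1) mF (hc.add hc) (fun n => ?_) hF
    filter_upwards [hFc n, bF] with x h1 h2
    exact (norm_sub_le _ _).trans (add_le_add h1 h2)

/-- The chain rule for smooth functions with bounded derivative. -/
theorem IsH10Pair.comp_left (h : IsH10Pair Ω u F) {j : ℝ → ℝ} (hj : ContDiff ℝ ∞ j)
    (hj0 : j 0 = 0) {C : NNReal} (hC : ∀ t, ‖deriv j t‖₊ ≤ C) :
    IsH10Pair Ω (fun x => j (u x)) (fun x => deriv j (u x) • F x) := by
  have hd : Continuous (deriv j) := hj.continuous_deriv (by simp)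
  have hlip : LipschitzWith C j :=
    lipschitzWith_of_nnnorm_deriv_le (hj.differentiable (by simp)) hC
  obtain ⟨φ', hφ', t1', t2'⟩ := h.exists_seq
  -- Convergence almost everywhere along a subsequence is needed because `deriv j` is merely
  -- continuous and bounded: the factor `deriv j (φ n x)` converges pointwise, and domination by
  -- C‖F‖ does the rest.
  obtain ⟨ns, hns, hae⟩ := exists_subseq_ae_of_tendsto_eLpNorm_two
    (fun n => (memLp_of_isTestFunction (hφ' n)).1) h.1.1 t1'
  set φ := fun n => φ' (ns n) with hφdef
  have hφ : ∀ n, IsTestFunction Ω (φ n) := fun n => hφ' _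
  have t1 := t1'.comp hns.tendsto_atTop
  have t2 := t2'.comp hns.tendsto_atTop
  have mF : ∀ {w : EuclideanSpace ℝ (Fin N) → ℝ}, AEStronglyMeasurable w (volume.restrict Ω) →
      AEStronglyMeasurable (fun x => deriv j (w x) • F x) (volume.restrict Ω) := fun hw =>
    (hd.comp_aestronglyMeasurable hw).smul h.2.1.1
  have bF : ∀ w : EuclideanSpace ℝ (Fin N) → ℝ, ∀ x, ‖deriv j (w x) • F x‖ ≤ C * ‖F x‖ := by
    intro w x
    rw [norm_smul]
    exact mul_le_mul_of_nonneg_right (hC _) (norm_nonneg _)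
  refine isH10Pair_of_tendsto (un := fun n x => j (φ n x))
    (Fn := fun n => ∇ (fun x => j (φ n x)))
    (fun n => isH10Pair_of_isTestFunction ((hφ n).comp_left hj hj0)) ?_ ?_ ?_ ?_
  · exact hlip.comp_memLp hj0 h.1
  · exact MemLp.mono' (h.2.1.norm.const_mul (C : ℝ)) (mF h.1.1) (Eventually.of_forall (bF u))
  · have := ENNReal.Tendsto.const_mul (a := (C : ℝ≥0∞)) t1 (Or.inr ENNReal.coe_ne_top)
    rw [mul_zero] at this
    refine tendsto_of_tendsto_of_tendsto_of_le_of_le tendsto_const_nhds this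
      (fun _ => zero_le) fun n => ?_
    refine eLpNorm_le_nnreal_smul_eLpNorm_of_ae_le_mul (Eventually.of_forall fun x => ?_) 2
    have := hlip.dist_le_mul (φ n x) (u x)
    rwa [dist_eq_norm, dist_eq_norm] at this
  · have s1 : Tendsto (fun n => eLpNorm (fun x => deriv j (φ n x) • F x - deriv j (u x) • F x) 2
        (volume.restrict Ω)) atTop (𝓝 0) := by
      refine tendsto_eLpNorm_two_of_dominated (fun n => mF (memLp_of_isTestFunction (hφ n)).1)
        (mF h.1.1) ((h.2.1.norm.const_mul (C : ℝ)).add (h.2.1.norm.const_mul (C : ℝ)))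
        (fun n => Eventually.of_forall fun x =>
          (norm_sub_le _ _).trans (add_le_add (bF _ x) (bF _ x))) ?_
      filter_upwards [hae] with x hx
      exact ((hd.tendsto _).comp hx).smul_const _
    have s2 := ENNReal.Tendsto.const_mul (a := (C : ℝ≥0∞)) t2 (Or.inr ENNReal.coe_ne_top)
    rw [mul_zero] at s2
    have s3 := s2.add s1
    rw [add_zero] at s3
    refine tendsto_of_tendsto_of_tendsto_of_le_of_le tendsto_const_nhds s3
      (fun _ => zero_le) fun n => ?_
    have mφ : AEStronglyMeasurable (fun x => deriv j (φ n x) • (∇ (φ n) x - F x))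
        (volume.restrict Ω) :=
      (hd.comp_aestronglyMeasurable (memLp_of_isTestFunction (hφ n)).1).smul
        ((memLp_gradient_of_isTestFunction (hφ n)).1.sub h.2.1.1)
    -- The error splits as j'(φₙ)(∇φₙ - F) + (j'(φₙ) - j'(u))F. The first term is at most C times
    -- the gradient error; the second is the dominated limit `s1`.
    calc eLpNorm (fun x => ∇ (fun x => j (φ n x)) x - deriv j (u x) • F x) 2 (volume.restrict Ω)
        = eLpNorm ((fun x => deriv j (φ n x) • (∇ (φ n) x - F x)) +
            fun x => deriv j (φ n x) • F x - deriv j (u x) • F x) 2 (volume.restrict Ω) := by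
          congr 1
          ext1 x
          rw [gradient_comp_left (hφ n) hj]
          simp [smul_sub]
      _ ≤ _ := eLpNorm_add_le mφ ((mF (memLp_of_isTestFunction (hφ n)).1).sub (mF h.1.1))
          (by norm_num)
      _ ≤ _ := by
        refine add_le_add ?_ le_rfl
        refine eLpNorm_le_nnreal_smul_eLpNorm_of_ae_le_mul (Eventually.of_forall fun x => ?_) 2
        rw [nnnorm_smul]
        exact mul_le_mul_of_nonneg_right (hC _) zero_le

/-- A smooth approximation of the absolute value with derivative `-c / √(1 + c²)` at `0`. -/
noncomputable def smoothAbs (c ε t : ℝ) : ℝ :=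
  Real.sqrt ((t - c * ε) ^ 2 + ε ^ 2) - Real.sqrt ((c * ε) ^ 2 + ε ^ 2)

theorem contDiff_smoothAbs (c : ℝ) {ε : ℝ} (hε : 0 < ε) : ContDiff ℝ ∞ (smoothAbs c ε) := by
  unfold smoothAbs
  refine ContDiff.sub (ContDiff.sqrt (by fun_prop) fun t => ?_) contDiff_const
  positivity

theorem deriv_smoothAbs (c : ℝ) {ε : ℝ} (hε : 0 < ε) (t : ℝ) :
    deriv (smoothAbs c ε) t = (t - c * ε) / Real.sqrt ((t - c * ε) ^ 2 + ε ^ 2) := by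
  have h1 : HasDerivAt (fun t => (t - c * ε) ^ 2 + ε ^ 2) (2 * (t - c * ε)) t := by
    have := (((hasDerivAt_id t).sub_const (c * ε)).pow 2).add_const (ε ^ 2)
    simpa using this
  have h2 := (h1.sqrt (by positivity)).sub_const (Real.sqrt ((c * ε) ^ 2 + ε ^ 2))
  have := h2.deriv
  rw [show smoothAbs c ε = fun t => Real.sqrt ((t - c * ε) ^ 2 + ε ^ 2) -
    Real.sqrt ((c * ε) ^ 2 + ε ^ 2) from rfl, this]
  rw [mul_div_mul_left _ _ two_ne_zero]

theorem abs_deriv_smoothAbs_le (c : ℝ) {ε : ℝ} (hε : 0 < ε) (t : ℝ) :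
    ‖deriv (smoothAbs c ε) t‖₊ ≤ 1 := by
  rw [deriv_smoothAbs c hε, ← NNReal.coe_le_coe, coe_nnnorm, Real.norm_eq_abs, abs_div,
    abs_of_nonneg (Real.sqrt_nonneg _), NNReal.coe_one]
  refine div_le_one_of_le₀ ?_ (Real.sqrt_nonneg _)
  exact Real.abs_le_sqrt (by nlinarith [sq_nonneg ε])

theorem tendsto_smoothAbs (c t : ℝ) {ε : ℕ → ℝ} (hε : Tendsto ε atTop (𝓝 0)) :
    Tendsto (fun n => smoothAbs c (ε n) t) atTop (𝓝 |t|) := by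
  have hc : Continuous fun e => smoothAbs c e t := by
    unfold smoothAbs
    fun_prop
  have := (hc.tendsto 0).comp hε
  simpa [smoothAbs, Real.sqrt_sq_eq_abs, Function.comp_def] using this

/-- The pointwise limit of the derivatives of `smoothAbs c ε` as `ε → 0`. -/
noncomputable def signAt (c t : ℝ) : ℝ := if t = 0 then -c / Real.sqrt (c ^ 2 + 1) else t / |t|

theorem tendsto_deriv_smoothAbs (c t : ℝ) {ε : ℕ → ℝ} (hpos : ∀ n, 0 < ε n)
    (hε : Tendsto ε atTop (𝓝 0)) :
    Tendsto (fun n => deriv (smoothAbs c (ε n)) t) atTop (𝓝 (signAt c t)) := by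
  simp only [deriv_smoothAbs c (hpos _)]
  unfold signAt
  split_ifs with h
  · subst h
    refine tendsto_const_nhds.congr fun n => ?_
    have : (0 - c * ε n) ^ 2 + ε n ^ 2 = (ε n) ^ 2 * (c ^ 2 + 1) := by ring
    rw [this, Real.sqrt_mul (by positivity), Real.sqrt_sq (hpos n).le,
      show 0 - c * ε n = ε n * (-c) by ring, mul_div_mul_left _ _ (hpos n).ne']
  · have hc : ContinuousAt (fun e => (t - c * e) / Real.sqrt ((t - c * e) ^ 2 + e ^ 2)) 0 := by
      refine ContinuousAt.div (by fun_prop) (by fun_prop) ?_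
      simpa [Real.sqrt_sq_eq_abs] using h
    have := hc.tendsto.comp hε
    simpa [Real.sqrt_sq_eq_abs, Function.comp_def] using this

/-- The parameter c shifts the kink of the approximation, leaving the limit |u| unchanged but
changing the limiting gradient on the zero set of u. This freedom is exploited in
`IsH10Pair.grad_eq_zero`. -/
theorem IsH10Pair.abs_signAt (h : IsH10Pair Ω u F) (c : ℝ) :
    IsH10Pair Ω (fun x => |u x|) (fun x => signAt c (u x) • F x) := by
  have hpos : ∀ n : ℕ, (0 : ℝ) < 1 / (n + 1) := fun n => by positivity
  have hlim := tendsto_one_div_add_atTop_nhds_zero_nat (𝕜 := ℝ)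
  have hz : ∀ n : ℕ, smoothAbs c (1 / (n + 1)) 0 = 0 := fun n => by simp [smoothAbs]
  refine isH10Pair_of_dominated (b := fun x => ‖u x‖) (c := fun x => ‖F x‖)
    (fun n : ℕ => h.comp_left (contDiff_smoothAbs c (hpos n)) (hz n)
      (abs_deriv_smoothAbs_le c (hpos n))) h.1.norm h.2.1.norm ?_ ?_ ?_ ?_
  · refine fun n => Eventually.of_forall fun x => ?_
    have := (lipschitzWith_of_nnnorm_deriv_le ((contDiff_smoothAbs c (hpos n)).differentiable
      (by simp)) (abs_deriv_smoothAbs_le c (hpos n))).dist_le_mul (u x) 0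
    rw [hz] at this
    simpa [dist_eq_norm] using this
  · refine fun n => Eventually.of_forall fun x => ?_
    rw [norm_smul]
    exact mul_le_of_le_one_left (norm_nonneg _) (abs_deriv_smoothAbs_le c (hpos n) _)
  · exact Eventually.of_forall fun x => tendsto_smoothAbs c _ hlim
  · exact Eventually.of_forall fun x => (tendsto_deriv_smoothAbs c _ hpos hlim).smul_const _

/-- The weak gradient vanishes almost everywhere on the zero set. -/
theorem IsH10Pair.grad_eq_zero (hΩ : IsOpen Ω) (h : IsH10Pair Ω u F) :
    ∀ᵐ x ∂volume.restrict Ω, u x = 0 → F x = 0 := by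
  -- The gradient of |u| is unique, yet on {u = 0} the choices c = 0 and c = 1 give 0 and -F/√2;
  -- hence F = 0 there.
  filter_upwards [(h.abs_signAt 0).ae_eq hΩ (h.abs_signAt 1)] with x hx h0
  simp only [signAt, h0, if_true] at hx
  have : (-1 / Real.sqrt (1 ^ 2 + 1) : ℝ) ≠ 0 := by positivity
  rw [neg_zero, zero_div, zero_smul] at hx
  exact (smul_eq_zero.1 hx.symm).resolve_left this

theorem IsH10Pair.abs (h : IsH10Pair Ω u F) :
    IsH10Pair Ω (fun x => |u x|) (fun x => (u x / |u x|) • F x) := by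
  refine (h.abs_signAt 0).congr_ae (ae_eq_refl _) (Eventually.of_forall fun x => ?_)
  -- Where u = 0 the convention 0 / 0 = 0 agrees with `signAt 0 0 = 0`.
  by_cases h0 : u x = 0 <;> simp [signAt, h0]

open Classical in
theorem IsH10Pair.posPart (hΩ : IsOpen Ω) (h : IsH10Pair Ω u F) :
    IsH10Pair Ω (fun x => max (u x) 0) (fun x => if 0 < u x then F x else 0) := by
  refine ((h.add h.abs).const_mul (1 / 2)).congr_ae (Eventually.of_forall fun x => ?_) ?_
  · simp only
    rcases le_total (u x) 0 with h0 | h0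
    · rw [max_eq_right h0, abs_of_nonpos h0]; ring
    · rw [max_eq_left h0, abs_of_nonneg h0]; ring
  · filter_upwards [h.grad_eq_zero hΩ] with x hx
    rcases lt_trichotomy (u x) 0 with h0 | h0 | h0
    · rw [if_neg h0.not_gt, abs_of_neg h0, div_neg, div_self h0.ne]; simp
    -- On the zero set the half-sum gives F/2 while the claim is 0; the two agree because F vanishes
    -- there.
    · simp [h0, hx h0]
    · rw [if_pos h0, abs_of_pos h0, div_self h0.ne', one_smul, ← two_smul ℝ, smul_smul]; norm_num

end Lattice

end SingQuasi

namespace SingQuasi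

/-! ### The nonlinearities -/

theorem deriv_g (t : ℝ) : deriv g t = 1 / Real.sqrt (1 + 2 * g t ^ 2) := (hasDerivAt_g t).deriv

theorem continuous_g : Continuous g :=
  continuous_iff_continuousAt.2 fun t => (hasDerivAt_g t).continuousAt

theorem continuous_deriv_g : Continuous (deriv g) := by
  rw [funext deriv_g]
  refine continuous_const.div (by have := continuous_g; fun_prop) fun t => ?_
  have := one_le_sqrt_aux (g t)
  positivity

theorem deriv_g_pos (t : ℝ) : 0 < deriv g t := by
  rw [deriv_g]
  have := one_le_sqrt_aux (g t)
  positivity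

theorem deriv_g_le_one (t : ℝ) : deriv g t ≤ 1 := by
  rw [deriv_g]
  exact div_le_one_of_le₀ (one_le_sqrt_aux _) (Real.sqrt_nonneg _)

theorem strictMono_g : StrictMono g := strictMono_of_deriv_pos deriv_g_pos

theorem g_pos {t : ℝ} (ht : 0 < t) : 0 < g t := g_zero ▸ strictMono_g ht

theorem g_nonneg {t : ℝ} (ht : 0 ≤ t) : 0 ≤ g t := g_zero ▸ strictMono_g.monotone ht

theorem g_le_self {t : ℝ} (ht : 0 ≤ t) : g t ≤ t := by
  have := monotone_gInv_sub (g_nonneg ht)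
  simp only [gInv_g, gInv_zero] at this
  linarith

theorem deriv_g_antitoneOn : AntitoneOn (deriv g) (Ici 0) := by
  intro s hs t ht hst
  rw [deriv_g, deriv_g]
  have h1 := one_le_sqrt_aux (g s)
  have h2 := strictMono_g.monotone hst
  have h3 := g_nonneg hs
  gcongr

/-- Concavity of g on the positive axis together with g(0) = 0: the secant slope g(t)/t is g' at an
intermediate point, where g' is at least g'(t). -/
theorem deriv_g_mul_le {t : ℝ} (ht : 0 < t) : deriv g t * t ≤ g t := by
  obtain ⟨ξ, hξ, h⟩ := exists_hasDerivAt_eq_slope g (deriv g) ht continuous_g.continuousOn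
    fun x _ => (deriv_g x) ▸ hasDerivAt_g x
  rw [g_zero, sub_zero, sub_zero, eq_div_iff ht.ne'] at h
  rw [← h]
  exact mul_le_mul_of_nonneg_right (deriv_g_antitoneOn hξ.1.le ht.le hξ.2.le) ht.le

/-- The singular nonlinearity `g^(-γ) g'`. -/
noncomputable def singNonlin (γ t : ℝ) : ℝ := g t ^ (-γ) * deriv g t

/-- The power nonlinearity `g^p g'`. -/
noncomputable def powNonlin (p t : ℝ) : ℝ := g t ^ p * deriv g t

section

variable {γ p s t M : ℝ}

theorem measurable_singNonlin (γ : ℝ) : Measurable (singNonlin γ) :=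
  (continuous_g.measurable.pow_const _).mul continuous_deriv_g.measurable

theorem continuous_powNonlin (hp : 0 ≤ p) : Continuous (powNonlin p) :=
  (continuous_g.rpow_const fun _ => Or.inr hp).mul continuous_deriv_g

theorem continuousOn_singNonlin (γ : ℝ) : ContinuousOn (singNonlin γ) (Ioi 0) :=
  (continuous_g.continuousOn.rpow_const fun _ hx => Or.inl (g_pos hx).ne').mul
    continuous_deriv_g.continuousOn

theorem singNonlin_pos (ht : 0 < t) : 0 < singNonlin γ t :=
  mul_pos (Real.rpow_pos_of_pos (g_pos ht) _) (deriv_g_pos t)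

/-- A product of two positive decreasing factors. It bounds the singular term between `vlo` and
`vhi` by its value at `vlo`, and it makes `singPrim` concave. -/
theorem singNonlin_antitoneOn (hγ : 0 < γ) : AntitoneOn (singNonlin γ) (Ioi 0) := by
  intro s hs t ht hst
  exact mul_le_mul (Real.rpow_le_rpow_of_nonpos (g_pos hs) (strictMono_g.monotone hst)
    (by linarith)) (deriv_g_antitoneOn (mem_Ici.2 (le_of_lt hs)) (mem_Ici.2 (le_of_lt ht)) hst) (deriv_g_pos t).le
    (Real.rpow_nonneg (g_pos hs).le _)

theorem powNonlin_nonneg (ht : 0 ≤ t) : 0 ≤ powNonlin p t :=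
  mul_nonneg (Real.rpow_nonneg (g_nonneg ht) _) (deriv_g_pos t).le

theorem powNonlin_le (hp : 0 ≤ p) (ht : 0 ≤ t) (hM : t ≤ M) : powNonlin p t ≤ M ^ p := by
  calc powNonlin p t ≤ g t ^ p * 1 :=
        mul_le_mul_of_nonneg_left (deriv_g_le_one t) (Real.rpow_nonneg (g_nonneg ht) _)
    _ = g t ^ p := mul_one _
    _ ≤ M ^ p := Real.rpow_le_rpow (g_nonneg ht) ((g_le_self ht).trans hM) hp

theorem hasDerivAt_singPrim (ht : 0 < t) : HasDerivAt (singPrim γ) (singNonlin γ t) t := by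
  have hg : HasDerivAt g (deriv g t) t := deriv_g t ▸ hasDerivAt_g t
  by_cases h : γ = 1
  · subst h
    have : singPrim 1 = fun t => Real.log (g t) := by
      ext t
      simp [singPrim]
    rw [this]
    refine (hg.log (g_pos ht).ne').congr_deriv ?_
    rw [singNonlin, Real.rpow_neg_one, div_eq_inv_mul]
  · have : singPrim γ = fun t => g t ^ (1 - γ) / (1 - γ) := by
      ext t
      simp [singPrim, h]
    rw [this]
    have h1 : 1 - γ ≠ 0 := sub_ne_zero.2 (Ne.symm h)
    refine ((hg.rpow_const (p := 1 - γ) (Or.inl (g_pos ht).ne')).div_const (1 - γ)).congr_deriv ?_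
    rw [singNonlin, show 1 - γ - 1 = -γ by ring]
    field_simp

theorem measurable_singPrim (γ : ℝ) : Measurable (singPrim γ) := by
  unfold singPrim
  have := continuous_g.measurable
  split_ifs <;> fun_prop

theorem continuous_singPrim (h : γ < 1) : Continuous (singPrim γ) := by
  have : singPrim γ = fun t => g t ^ (1 - γ) / (1 - γ) := by
    ext t
    simp [singPrim, h.ne]
  rw [this]
  exact (continuous_g.rpow_const fun _ => Or.inr (by linarith)).div_const _

/-- `singPrim` is concave: its graph lies below its tangents. -/
theorem singPrim_sub_le (hγ : 0 < γ) (hs : 0 < s) (ht : 0 ≤ t) (h : 1 ≤ γ → t ≠ 0) :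
    singPrim γ t - singPrim γ s ≤ singNonlin γ s * (t - s) := by
  -- The mean value theorem may have 0 as an endpoint. For γ < 1 the primitive is continuous there;
  -- for γ ≥ 1 the hypothesis `h` excludes t = 0.
  have hcont : ∀ x, x ≠ 0 ∨ γ < 1 → 0 ≤ x → ContinuousAt (singPrim γ) x := by
    intro x hx h0
    by_cases h1 : γ < 1
    · exact (continuous_singPrim h1).continuousAt
    · exact (hasDerivAt_singPrim (h0.lt_of_ne (hx.resolve_right h1).symm)).continuousAt
  rcases lt_trichotomy t s with hts | rfl | hts
  · obtain ⟨ξ, hξ, h⟩ := exists_hasDerivAt_eq_slope (singPrim γ) (singNonlin γ) hts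
      (fun x hx => (hcont x (by
        by_contra! hc
        exact h hc.2 (le_antisymm (hc.1 ▸ hx.1) ht)) (ht.trans hx.1)).continuousWithinAt)
      fun x hx => hasDerivAt_singPrim (ht.trans_lt hx.1)
    rw [eq_div_iff (sub_pos.2 hts).ne'] at h
    have := singNonlin_antitoneOn hγ (mem_Ioi.2 (ht.trans_lt hξ.1)) hs hξ.2.le
    nlinarith
  · simp
  · obtain ⟨ξ, hξ, h⟩ := exists_hasDerivAt_eq_slope (singPrim γ) (singNonlin γ) hts
      (fun x hx => (hcont x (Or.inl (hs.trans_le hx.1).ne')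
        (hs.trans_le hx.1).le).continuousWithinAt)
      fun x hx => hasDerivAt_singPrim (hs.trans hx.1)
    rw [eq_div_iff (sub_pos.2 hts).ne'] at h
    have := singNonlin_antitoneOn hγ hs (mem_Ioi.2 (hs.trans hξ.1)) hξ.1.le
    nlinarith

theorem rpow_le_singNonlin (hM : 0 ≤ M) (ht : 0 < t) (htM : t ≤ M) :
    g t ^ (-γ) * deriv g M ≤ singNonlin γ t :=
  mul_le_mul_of_nonneg_left (deriv_g_antitoneOn ht.le hM htM) (Real.rpow_nonneg (g_pos ht).le _)

/-- Here |G| = g · g^(-γ)/|1 - γ|, with g(t) ≤ t and g' ≥ g'(M) on (0, M]. The bound is in terms of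
`singNonlin γ t * t`, which at t = `vlo x` is integrable against a because `vlo` is itself an
admissible test function. -/
theorem abs_singPrim_le_of_ne_one (hγ : γ ≠ 1) (hM : 0 ≤ M) (ht : 0 < t) (htM : t ≤ M) :
    |singPrim γ t| ≤ 1 / (deriv g M * |1 - γ|) * (singNonlin γ t * t) := by
  have h1 : 0 < |1 - γ| := abs_pos.2 (sub_ne_zero.2 hγ.symm)
  have h2 := deriv_g_pos M
  have h3 := Real.rpow_pos_of_pos (g_pos ht) (-γ)
  have h4 := rpow_le_singNonlin (γ := γ) hM ht htM
  have h5 := g_le_self ht.le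
  rw [singPrim, if_neg hγ, abs_div, abs_of_pos (Real.rpow_pos_of_pos (g_pos ht) _),
    sub_eq_add_neg, Real.rpow_add (g_pos ht), Real.rpow_one, ← sub_eq_add_neg, div_le_iff₀ h1]
  have : 1 / (deriv g M * |1 - γ|) * (singNonlin γ t * t) * |1 - γ| =
    singNonlin γ t * t / deriv g M := by field_simp
  rw [this, le_div_iff₀ h2]
  calc g t * g t ^ (-γ) * deriv g M = (g t ^ (-γ) * deriv g M) * g t := by ring
    _ ≤ singNonlin γ t * t := mul_le_mul h4 h5 (g_pos ht).le (singNonlin_pos ht).le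

/-- With s = φ(x) from (H), each term on the right becomes integrable against a. The lower bound for
the logarithm comes from g(t) ≥ c t and -log t = log(s/t) - log s ≤ s/t + 1/s. -/
theorem abs_singPrim_one_le (hM : 0 ≤ M) (ht : 0 < t) (htM : t ≤ M) (hs : 0 < s) :
    |singPrim 1 t| ≤ M / deriv g M * (singNonlin 1 t * t) +
      1 / deriv g M ^ 2 * (singNonlin 1 t * t) + 1 / deriv g M * (singNonlin 1 t * s) +
        s ^ (-1 : ℝ) := by
  set c := deriv g M with hc
  have hc0 : 0 < c := deriv_g_pos M
  have hgp := g_pos ht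
  have hgt := g_le_self ht.le
  have h4 := rpow_le_singNonlin (γ := 1) hM ht htM
  rw [Real.rpow_neg_one, ← hc] at h4
  have hinv : 1 / t ≤ (g t)⁻¹ := by
    rw [← one_div]
    exact one_div_le_one_div_of_le hgp hgt
  -- Constants are absorbed into `singNonlin 1 t * t`, which is bounded below by c, so that no
  -- constant has to be integrated against a.
  have hct : c ≤ singNonlin 1 t * t := by
    calc c = 1 / t * c * t := by field_simp
      _ ≤ singNonlin 1 t * t := by gcongr; exact (by gcongr : 1 / t * c ≤ (g t)⁻¹ * c).trans h4
  have hS := singNonlin_pos (γ := 1) ht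
  have hcg : c * t ≤ g t := (mul_le_mul_of_nonneg_right
    (deriv_g_antitoneOn ht.le hM htM) ht.le).trans (deriv_g_mul_le ht)
  rw [Real.rpow_neg_one]
  have e1 : singPrim 1 t = Real.log (g t) := by simp [singPrim]
  rw [e1]
  have b1 : Real.log (g t) ≤ M / c * (singNonlin 1 t * t) := by
    calc Real.log (g t) ≤ g t := Real.log_le_self hgp.le
      _ ≤ M / c * c := by rw [div_mul_cancel₀ _ hc0.ne']; exact hgt.trans htM
      _ ≤ _ := by gcongr
  have b2 : -Real.log (g t) ≤ 1 / c ^ 2 * (singNonlin 1 t * t) +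
      1 / c * (singNonlin 1 t * s) + s⁻¹ := by
    have l1 : Real.log (c * t) ≤ Real.log (g t) := Real.log_le_log (by positivity) hcg
    rw [Real.log_mul hc0.ne' ht.ne'] at l1
    have l2 : -Real.log c ≤ 1 / c := by
      have := Real.log_le_self (one_div_pos.2 hc0).le
      rwa [one_div, Real.log_inv, ← one_div] at this
    have l3 : Real.log s - Real.log t ≤ s / t := by
      rw [← Real.log_div hs.ne' ht.ne']
      exact Real.log_le_self (by positivity)
    have l4 : -Real.log s ≤ s⁻¹ := by
      rw [← Real.log_inv]
      exact Real.log_le_self (by positivity)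
    have l5 : 1 / c ≤ 1 / c ^ 2 * (singNonlin 1 t * t) := by
      calc 1 / c = 1 / c ^ 2 * c := by field_simp
        _ ≤ _ := by gcongr
    have l6 : s / t ≤ 1 / c * (singNonlin 1 t * s) := by
      calc s / t = 1 / c * (1 / t * c * s) := by field_simp
        _ ≤ _ := by gcongr; exact (by gcongr : 1 / t * c ≤ (g t)⁻¹ * c).trans h4
    linarith
  have p1 : 0 ≤ M / c * (singNonlin 1 t * t) := by positivity
  have p2 : 0 ≤ 1 / c ^ 2 * (singNonlin 1 t * t) := by positivity
  have p3 : 0 ≤ 1 / c * (singNonlin 1 t * s) := by positivity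
  have p4 : 0 ≤ s⁻¹ := by positivity
  rw [abs_le]
  constructor <;> linarith

end

/-! ### Primitives of truncated functions -/

/-- The primitive, vanishing at `lo`, of `h` frozen below `lo` and above `hi`. -/
noncomputable def clampPrim (h : ℝ → ℝ) (lo hi t : ℝ) : ℝ :=
  ∫ s in lo..t, h (max lo (min s hi))

section

variable {h H : ℝ → ℝ} {lo hi s t B : ℝ}

/-- The affine substitution from [lo, t] to [0, 1] moves the variable endpoints into the integrand;
what remains is a parameter integral of a jointly measurable function. -/
theorem measurable_clampPrim (hh : Measurable h) :
    Measurable fun q : ℝ × ℝ × ℝ => clampPrim h q.1 q.2.1 q.2.2 := by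
  have e : ∀ q : ℝ × ℝ × ℝ, clampPrim h q.1 q.2.1 q.2.2 =
      ∫ τ in Ioc (0 : ℝ) 1, (q.2.2 - q.1) *
        h (max q.1 (min ((q.2.2 - q.1) * τ + q.1) q.2.1)) := by
    intro q
    rw [← intervalIntegral.integral_of_le zero_le_one, intervalIntegral.integral_const_mul,
      intervalIntegral.mul_integral_comp_mul_add (f := fun s => h (max q.1 (min s q.2.1)))]
    simp [clampPrim]
  simp only [e]
  have hm : Measurable fun z : (ℝ × ℝ × ℝ) × ℝ => (z.1.2.2 - z.1.1) *
      h (max z.1.1 (min ((z.1.2.2 - z.1.1) * z.2 + z.1.1) z.1.2.1)) := by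
    refine Measurable.mul (by fun_prop) (hh.comp ?_)
    fun_prop
  exact (hm.stronglyMeasurable.integral_prod_right (ν := volume.restrict (Ioc (0 : ℝ) 1))).measurable

theorem continuous_comp_clamp (hh : ContinuousOn h (Icc lo hi)) (hle : lo ≤ hi) :
    Continuous fun s => h (max lo (min s hi)) :=
  hh.comp_continuous (by fun_prop) fun s => ⟨le_max_left _ _, max_le hle (min_le_right _ _)⟩

theorem clampPrim_sub (hh : ContinuousOn h (Icc lo hi)) (hle : lo ≤ hi) :
    clampPrim h lo hi t - clampPrim h lo hi s = ∫ τ in s..t, h (max lo (min τ hi)) :=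
  intervalIntegral.integral_interval_sub_left
    ((continuous_comp_clamp hh hle).intervalIntegrable _ _)
    ((continuous_comp_clamp hh hle).intervalIntegrable _ _)

theorem hasDerivAt_clampPrim (hh : ContinuousOn h (Icc lo hi)) (hle : lo ≤ hi) (t : ℝ) :
    HasDerivAt (clampPrim h lo hi) (h (max lo (min t hi))) t :=
  intervalIntegral.integral_hasDerivAt_right
    ((continuous_comp_clamp hh hle).intervalIntegrable _ _)
    ((continuous_comp_clamp hh hle).stronglyMeasurableAtFilter _ _)
    (continuous_comp_clamp hh hle).continuousAt

theorem abs_clampPrim_sub_le (hh : ContinuousOn h (Icc lo hi)) (hle : lo ≤ hi)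
    (hB : ∀ s ∈ Icc lo hi, |h s| ≤ B) :
    |clampPrim h lo hi t - clampPrim h lo hi s| ≤ B * |t - s| := by
  rw [clampPrim_sub hh hle]
  exact intervalIntegral.norm_integral_le_of_norm_le_const
    (f := fun τ => h (max lo (min τ hi))) fun τ _ => hB _ ⟨le_max_left _ _, max_le hle (min_le_right _ _)⟩

@[simp] theorem clampPrim_self : clampPrim h lo hi lo = 0 := intervalIntegral.integral_same

theorem clampPrim_sub_of_ge (hh : ContinuousOn h (Icc lo hi)) (hle : lo ≤ hi) (ht : hi ≤ t) :
    clampPrim h lo hi t - clampPrim h lo hi hi = h hi * (t - hi) := by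
  rw [clampPrim_sub hh hle, intervalIntegral.integral_congr (g := fun _ => h hi),
    intervalIntegral.integral_const, smul_eq_mul, mul_comm]
  intro τ hτ
  rw [uIcc_of_le ht] at hτ
  simp [min_eq_right hτ.1, hle]

theorem clampPrim_of_le (hle : lo ≤ hi) (ht : t ≤ lo) :
    clampPrim h lo hi t = h lo * (t - lo) := by
  rw [clampPrim, intervalIntegral.integral_congr (g := fun _ => h lo),
    intervalIntegral.integral_const, smul_eq_mul, mul_comm]
  intro τ hτ
  rw [uIcc_of_ge ht] at hτ
  simp [min_eq_left (hτ.2.trans hle), hτ.2]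

theorem clampPrim_eq_sub (hH : ∀ s ∈ Icc lo hi, HasDerivAt H (h s) s)
    (hh : ContinuousOn h (Icc lo hi)) (hlt : lo ≤ t) (hti : t ≤ hi) :
    clampPrim h lo hi t = H t - H lo := by
  have hsub : uIcc lo t ⊆ Icc lo hi := by
    rw [uIcc_of_le hlt]
    exact Icc_subset_Icc_right hti
  rw [← intervalIntegral.integral_eq_sub_of_hasDerivAt (f := H) (f' := h)
    (fun s hs => hH s (hsub hs)) ((hh.mono hsub).intervalIntegrable), clampPrim]
  refine intervalIntegral.integral_congr fun s hs => ?_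
  have := hsub hs
  simp only [min_eq_left this.2, max_eq_right this.1]

/-- The tangent inequality for `clampPrim` outside `[lo, hi]`. -/
theorem clampPrim_sub_clamp (hh : ContinuousOn h (Icc lo hi)) (hle : lo ≤ hi) :
    clampPrim h lo hi t - clampPrim h lo hi (max lo (min t hi)) =
      h hi * max (t - hi) 0 - h lo * max (lo - t) 0 := by
  rcases le_total t lo with h1 | h1
  · rw [min_eq_left (h1.trans hle), max_eq_left h1, clampPrim_self, clampPrim_of_le hle h1,
      max_eq_right (by linarith), max_eq_left (by linarith)]
    ring
  rcases le_total t hi with h2 | h2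
  · rw [min_eq_left h2, max_eq_right h1, max_eq_right (by linarith), max_eq_right (by linarith)]
    ring
  · rw [min_eq_right h2, max_eq_right hle, clampPrim_sub_of_ge hh hle h2,
      max_eq_left (by linarith), max_eq_right (by linarith)]
    ring

end

/-- Both primitives have the same integrand but start at 0 and at `lo` respectively, so only their
increments agree. -/
theorem truncPrim_sub {p lo hi : ℝ} (hp : 0 ≤ p) (hle : lo ≤ hi) (s t : ℝ) :
    truncPrim p lo hi t - truncPrim p lo hi s =
      clampPrim (powNonlin p) lo hi t - clampPrim (powNonlin p) lo hi s := by
  have e : ∀ τ, truncNonlin p lo hi τ = powNonlin p (max lo (min τ hi)) := by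
    intro τ
    unfold truncNonlin
    split_ifs with h1 h2
    · rw [min_eq_left (h1.trans hle), max_eq_left h1, powNonlin]
    · rw [min_eq_left h2, max_eq_right (not_le.1 h1).le, powNonlin]
    · rw [min_eq_right (not_le.1 h2).le, max_eq_right hle, powNonlin]
  have hc := (continuous_powNonlin hp).continuousOn (s := Icc lo hi)
  rw [clampPrim_sub hc hle]
  simp only [truncPrim, e]
  exact intervalIntegral.integral_interval_sub_left
    ((continuous_comp_clamp hc hle).intervalIntegrable _ _)
    ((continuous_comp_clamp hc hle).intervalIntegrable _ _)

end SingQuasi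

namespace SingQuasi

/-! ### Minimisation of submodular energies -/

/-- A submodular function on a lattice has a minimising sequence which is Cauchy with respect to
a given bounded function `S`. -/
theorem exists_minimizing_seq_of_submodular {X : Type*} [Lattice X] {K : Set X} {J S : X → ℝ}
    (hne : K.Nonempty) (hsup : ∀ u ∈ K, ∀ w ∈ K, u ⊔ w ∈ K) (hinf : ∀ u ∈ K, ∀ w ∈ K, u ⊓ w ∈ K)
    (hJ : ∀ u ∈ K, ∀ w ∈ K, J (u ⊔ w) + J (u ⊓ w) ≤ J u + J w)
    (hbelow : BddBelow (J '' K)) (habove : BddAbove (S '' K)) (hS : ∀ u ∈ K, 0 ≤ S u) :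
    ∃ u : ℕ → X, (∀ n, u n ∈ K) ∧ Tendsto (fun n => J (u n)) atTop (𝓝 (sInf (J '' K))) ∧
      ∀ ε > 0, ∃ n₀ : ℕ, ∀ m ≥ n₀, ∀ n ≥ n₀, 2 * S (u m ⊔ u n) - S (u m) - S (u n) < ε := by
  set μ := sInf (J '' K) with hμ
  have hμle : ∀ u ∈ K, μ ≤ J u := fun u hu => csInf_le hbelow ⟨u, hu, rfl⟩
  set A : ℕ → Set X := fun n => {u ∈ K | J u ≤ μ + (1 / 2) ^ n} with hA
  have hpow : ∀ n : ℕ, (0 : ℝ) < (1 / 2) ^ n := fun n => by positivity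
  have hAne : ∀ n, (A n).Nonempty := by
    intro n
    obtain ⟨_, ⟨u, hu, rfl⟩, h⟩ := exists_lt_of_csInf_lt (hne.image J)
      (lt_add_of_pos_right μ (hpow n))
    exact ⟨u, hu, h.le⟩
  have hAanti : ∀ {m n : ℕ}, m ≤ n → A n ⊆ A m := fun {m n} hmn u hu =>
    ⟨hu.1, hu.2.trans (add_le_add le_rfl
      (pow_le_pow_of_le_one (by norm_num) (by norm_num) hmn))⟩
  have hAbdd : ∀ n, BddAbove (S '' A n) := fun n => habove.mono (image_mono fun u hu => hu.1)
  set σ : ℕ → ℝ := fun n => sSup (S '' A n) with hσ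
  have hle : ∀ n, ∀ u ∈ A n, S u ≤ σ n := fun n u hu => le_csSup (hAbdd n) ⟨u, hu, rfl⟩
  have hσanti : Antitone σ := fun m n hmn =>
    csSup_le_csSup (hAbdd m) ((hAne n).image S) (image_mono (hAanti hmn))
  have hσnonneg : ∀ n, 0 ≤ σ n := fun n => by
    obtain ⟨u, hu⟩ := hAne n
    exact (hS u hu.1).trans (hle n u hu)
  have hbddσ : BddBelow (range σ) := ⟨0, by rintro _ ⟨n, rfl⟩; exact hσnonneg n⟩
  have hσlim := tendsto_atTop_ciInf hσanti hbddσ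
  set σ₀ := ⨅ n, σ n
  have hσ₀ : ∀ n, σ₀ ≤ σ n := fun n => ciInf_le hbddσ n
  -- The choice that replaces compactness: `u n` almost minimises J and, among such functions,
  -- almost maximises S.
  have hex : ∀ n, ∃ u ∈ A n, σ n - (1 / 2) ^ n ≤ S u := by
    intro n
    obtain ⟨_, ⟨u, hu, rfl⟩, h⟩ := exists_lt_of_lt_csSup ((hAne n).image S)
      (sub_lt_self (σ n) (hpow n))
    exact ⟨u, hu, h.le⟩
  choose u hu hSu using hex
  have hpow0 : Tendsto (fun n : ℕ => ((1 : ℝ) / 2) ^ n) atTop (𝓝 0) :=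
    tendsto_pow_atTop_nhds_zero_of_lt_one (by norm_num) (by norm_num)
  refine ⟨u, fun n => (hu n).1, ?_, ?_⟩
  · refine tendsto_of_tendsto_of_tendsto_of_le_of_le tendsto_const_nhds ?_
      (fun n => hμle _ (hu n).1) (fun n => (hu n).2)
    simpa using hpow0.const_add μ
  · intro ε hε
    have hlim : Tendsto (fun n => 2 * (σ n - σ₀) + 2 * (1 / 2) ^ n) atTop (𝓝 0) := by
      have := ((hσlim.sub_const σ₀).const_mul 2).add (hpow0.const_mul 2)
      simpa using this
    obtain ⟨k, hk⟩ := (hlim.eventually (gt_mem_nhds hε)).exists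
    have hj : ∀ n ≥ k + 1, ((1 : ℝ) / 2) ^ n ≤ (1 / 2) ^ k / 2 := fun n hn => by
      calc ((1 : ℝ) / 2) ^ n ≤ (1 / 2) ^ (k + 1) :=
            pow_le_pow_of_le_one (by norm_num) (by norm_num) hn
        _ = _ := by ring
    refine ⟨k + 1, fun m hm n hn => ?_⟩
    -- The infimum has energy at least μ, so by submodularity the supremum has energy at most μ +
    -- 2^(-k); the shift to k + 1 pays for the two errors. Hence S of the supremum is at most σ k,
    -- hardly more than S(u m) and S(u n).
    have hmem : u m ⊔ u n ∈ A k := by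
      refine ⟨hsup _ (hu m).1 _ (hu n).1, ?_⟩
      have := hJ _ (hu m).1 _ (hu n).1
      have := hμle _ (hinf _ (hu m).1 _ (hu n).1)
      linarith [(hu m).2, (hu n).2, hj m hm, hj n hn]
    linarith [hle k _ hmem, hSu m, hSu n, hσ₀ m, hσ₀ n, hj m hm, hj n hn, hpow k]

/-! ### The energy on the lattice of H¹₀ functions. -/

variable {N : ℕ} {Ω : Set (EuclideanSpace ℝ (Fin N))}

theorem norm_toLp_two_sq {α : Type*} [MeasurableSpace α] {μ : Measure α} {V : Type*}
    [NormedAddCommGroup V] [InnerProductSpace ℝ V] {f : α → V} (hf : MemLp f 2 μ) :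
    ‖hf.toLp f‖ ^ 2 = ∫ x, ‖f x‖ ^ 2 ∂μ := by
  rw [← real_inner_self_eq_norm_sq, L2.inner_def]
  apply integral_congr_ae
  filter_upwards [hf.coeFn_toLp] with x hx
  rw [hx, real_inner_self_eq_norm_sq]

/-- The energy `½ ∫_Ω |∇u|² - ∫_Ω Φ(x, u)`. -/
noncomputable def energy (Ω : Set (EuclideanSpace ℝ (Fin N)))
    (Φ : EuclideanSpace ℝ (Fin N) → ℝ → ℝ) (u : EuclideanSpace ℝ (Fin N) → ℝ) : ℝ :=
  1 / 2 * (∫ x in Ω, ‖wgrad Ω u x‖ ^ 2) - ∫ x in Ω, Φ x (u x)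

section

variable {u w : EuclideanSpace ℝ (Fin N) → ℝ}
  {F G : EuclideanSpace ℝ (Fin N) → EuclideanSpace ℝ (Fin N)}

theorem IsH10Pair.integral_wgrad_sq (hΩ : IsOpen Ω) (h : IsH10Pair Ω u F) :
    ∫ x in Ω, ‖wgrad Ω u x‖ ^ 2 = ∫ x in Ω, ‖F x‖ ^ 2 := by
  apply integral_congr_ae
  filter_upwards [h.wgrad_ae_eq hΩ] with x hx
  rw [hx]

theorem IsH10Pair.energy_eq (hΩ : IsOpen Ω) (h : IsH10Pair Ω u F)
    (Φ : EuclideanSpace ℝ (Fin N) → ℝ → ℝ) :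
    energy Ω Φ u = 1 / 2 * (∫ x in Ω, ‖F x‖ ^ 2) - ∫ x in Ω, Φ x (u x) := by
  rw [energy, h.integral_wgrad_sq hΩ]

theorem integrable_norm_sq {α : Type*} [MeasurableSpace α] {μ : Measure α} {V : Type*}
    [NormedAddCommGroup V] {f : α → V} (hf : MemLp f 2 μ) :
    Integrable (fun x => ‖f x‖ ^ 2) μ :=
  hf.integrable_norm_pow two_ne_zero

theorem IsH10Pair.sup (h : IsH10Pair Ω u F) (h' : IsH10Pair Ω w G) :
    IsH10Pair Ω (u ⊔ w) (fun x => (1 / 2 : ℝ) •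
      ((F x + G x) + ((u x - w x) / |u x - w x|) • (F x - G x))) := by
  refine (((h.add h').add (h.sub h').abs).const_mul (1 / 2)).congr_ae
    (Eventually.of_forall fun x => ?_) (ae_eq_refl _)
  simp only [Pi.sup_apply]
  rcases le_total (u x) (w x) with h | h
  · rw [sup_eq_right.2 h, abs_of_nonpos (sub_nonpos.2 h)]; ring
  · rw [sup_eq_left.2 h, abs_of_nonneg (sub_nonneg.2 h)]; ring

theorem IsH10Pair.inf (h : IsH10Pair Ω u F) (h' : IsH10Pair Ω w G) :
    IsH10Pair Ω (u ⊓ w) (fun x => (1 / 2 : ℝ) •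
      ((F x + G x) - ((u x - w x) / |u x - w x|) • (F x - G x))) := by
  refine (((h.add h').sub (h.sub h').abs).const_mul (1 / 2)).congr_ae
    (Eventually.of_forall fun x => ?_) (ae_eq_refl _)
  simp only [Pi.inf_apply]
  rcases le_total (u x) (w x) with h | h
  · rw [inf_eq_left.2 h, abs_of_nonpos (sub_nonpos.2 h)]; ring
  · rw [inf_eq_right.2 h, abs_of_nonneg (sub_nonneg.2 h)]; ring

/-- The energy is submodular. -/
theorem energy_sup_add_energy_inf_le (hΩ : IsOpen Ω) (hu : MemH10 Ω u) (hw : MemH10 Ω w)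
    {Φ : EuclideanSpace ℝ (Fin N) → ℝ → ℝ}
    (iu : IntegrableOn (fun x => Φ x (u x)) Ω) (iw : IntegrableOn (fun x => Φ x (w x)) Ω)
    (is : IntegrableOn (fun x => Φ x ((u ⊔ w) x)) Ω)
    (ii : IntegrableOn (fun x => Φ x ((u ⊓ w) x)) Ω) :
    energy Ω Φ (u ⊔ w) + energy Ω Φ (u ⊓ w) ≤ energy Ω Φ u + energy Ω Φ w := by
  have hu := hu.isH10Pair
  have hw := hw.isH10Pair
  have hs := hu.sup hw
  have hi := hu.inf hw
  rw [hs.energy_eq hΩ, hi.energy_eq hΩ, energy, energy]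
  -- At each point the maximum and the minimum are the two values u and w in some order, so the
  -- lower-order term is exactly modular.
  have e1 : (∫ x in Ω, Φ x ((u ⊔ w) x)) + ∫ x in Ω, Φ x ((u ⊓ w) x) =
      (∫ x in Ω, Φ x (u x)) + ∫ x in Ω, Φ x (w x) := by
    rw [← integral_add is ii, ← integral_add iu iw]
    congr 1
    ext x
    simp only [Pi.sup_apply, Pi.inf_apply]
    rcases le_total (u x) (w x) with h | h
    · rw [sup_eq_right.2 h, inf_eq_left.2 h, add_comm]
    · rw [sup_eq_left.2 h, inf_eq_right.2 h]
  have e2 := integral_mono ((integrable_norm_sq hs.memLp_grad).add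
    (integrable_norm_sq hi.memLp_grad)) ((integrable_norm_sq hu.memLp_grad).add
    (integrable_norm_sq hw.memLp_grad)) (fun x => ?_)
  · simp only [Pi.add_apply] at e2
    rw [integral_add (integrable_norm_sq hs.memLp_grad) (integrable_norm_sq hi.memLp_grad),
      integral_add (integrable_norm_sq hu.memLp_grad) (integrable_norm_sq hw.memLp_grad)] at e2
    linarith
  · simp only [Pi.add_apply]
    set F := wgrad Ω u x
    set G := wgrad Ω w x
    set c := (u x - w x) / |u x - w x|
    have hc : |c| ≤ 1 := by
      rw [abs_div, abs_abs]
      exact div_self_le_one _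
    -- The gradients of the maximum and the minimum are ½((F + G) ± c(F - G)) with |c| ≤ 1. Their
    -- squares sum to ½(|F + G|² + c²|F - G|²), at most |F|² + |G|².
    have h1 := parallelogram_law_with_norm ℝ (F + G) (c • (F - G))
    have h2 := parallelogram_law_with_norm ℝ F G
    have h3 : ‖c • (F - G)‖ * ‖c • (F - G)‖ ≤ ‖F - G‖ * ‖F - G‖ := by
      have : ‖c • (F - G)‖ ≤ ‖F - G‖ := by
        rw [norm_smul]
        exact mul_le_of_le_one_left (norm_nonneg _) hc
      gcongr
    rw [norm_smul, norm_smul, mul_pow, mul_pow]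
    norm_num
    nlinarith

/-- Convexity of the quadratic part of the energy. -/
theorem integral_norm_sub_sq_eq (hΩ : IsOpen Ω) (hu : MemH10 Ω u) (hw : MemH10 Ω w)
    {Φ : EuclideanSpace ℝ (Fin N) → ℝ → ℝ} :
    1 / 4 * ∫ x in Ω, ‖wgrad Ω u x - wgrad Ω w x‖ ^ 2 =
      energy Ω Φ u + energy Ω Φ w - 2 * energy Ω Φ (fun x => 1 / 2 * (u x + w x)) +
      ((∫ x in Ω, Φ x (u x)) + (∫ x in Ω, Φ x (w x)) -
        2 * ∫ x in Ω, Φ x (1 / 2 * (u x + w x))) := by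
  have hu := hu.isH10Pair
  have hw := hw.isH10Pair
  have hm := (hu.add hw).const_mul (1 / 2)
  have hd := hu.sub hw
  rw [hm.energy_eq hΩ, energy, energy]
  have : (∫ x in Ω, ‖wgrad Ω u x - wgrad Ω w x‖ ^ 2) +
      4 * (∫ x in Ω, ‖(1 / 2 : ℝ) • (wgrad Ω u x + wgrad Ω w x)‖ ^ 2) =
      2 * (∫ x in Ω, ‖wgrad Ω u x‖ ^ 2) + 2 * ∫ x in Ω, ‖wgrad Ω w x‖ ^ 2 := by
    rw [← integral_const_mul, ← integral_const_mul, ← integral_const_mul,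
      ← integral_add (integrable_norm_sq hd.memLp_grad)
        ((integrable_norm_sq hm.memLp_grad).const_mul 4),
      ← integral_add ((integrable_norm_sq hu.memLp_grad).const_mul 2)
        ((integrable_norm_sq hw.memLp_grad).const_mul 2)]
    congr 1
    ext x
    have h2 := parallelogram_law_with_norm ℝ (wgrad Ω u x) (wgrad Ω w x)
    rw [norm_smul, mul_pow]
    norm_num
    nlinarith
  linarith

end

/-- The functions of `H¹₀(Ω)` between `lo` and `hi`. -/
def between (Ω : Set (EuclideanSpace ℝ (Fin N))) (lo hi : EuclideanSpace ℝ (Fin N) → ℝ) :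
    Set (EuclideanSpace ℝ (Fin N) → ℝ) :=
  {u | MemH10 Ω u ∧ ∀ᵐ x ∂volume.restrict Ω, lo x ≤ u x ∧ u x ≤ hi x}

section

variable {lo hi b : EuclideanSpace ℝ (Fin N) → ℝ} {Φ : EuclideanSpace ℝ (Fin N) → ℝ → ℝ} {M : ℝ}

/-- The function b is both the Lipschitz constant of Φ and the weight in S, so the distance that the
lattice argument controls also controls the lower-order term. The conditions b ≥ 1 and hi - lo ≤ M
turn this weighted L¹ distance into an L² distance. -/
theorem exists_isMinOn_energy (hΩ : IsOpen Ω)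
    (hlo : MemH10 Ω lo)
    (hle : ∀ᵐ x ∂volume.restrict Ω, lo x ≤ hi x)
    (hM : ∀ᵐ x ∂volume.restrict Ω, hi x - lo x ≤ M)
    (hbm : AEStronglyMeasurable b (volume.restrict Ω))
    (hb1 : ∀ᵐ x ∂volume.restrict Ω, 1 ≤ b x)
    (hbi : IntegrableOn (fun x => b x * (hi x - lo x)) Ω)
    (hΦm : ∀ u, MemH10 Ω u → AEStronglyMeasurable (fun x => Φ x (u x)) (volume.restrict Ω))
    (hΦ0 : ∀ x, Φ x (lo x) = 0)
    (hΦ : ∀ᵐ x ∂volume.restrict Ω, ∀ s t, |Φ x s - Φ x t| ≤ b x * |s - t|) :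
    ∃ v ∈ between Ω lo hi, IsMinOn (energy Ω Φ) (between Ω lo hi) v := by
  set K := between Ω lo hi with hK
  have mK : ∀ u ∈ K, MemLp u 2 (volume.restrict Ω) := fun u hu => hu.1.isH10Pair.memLp
  have hdiff : ∀ u ∈ K, ∀ w ∈ K, ∀ᵐ x ∂volume.restrict Ω, |u x - w x| ≤ hi x - lo x := by
    intro u hu w hw
    filter_upwards [hu.2, hw.2] with x h1 h2
    rw [abs_le]
    constructor <;> linarith [h1.1, h1.2, h2.1, h2.2]
  have hbd : ∀ u ∈ K, ∀ w ∈ K, IntegrableOn (fun x => b x * |u x - w x|) Ω := by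
    intro u hu w hw
    refine Integrable.mono' hbi (hbm.mul ((mK u hu).1.sub (mK w hw).1).norm) ?_
    filter_upwards [hb1, hdiff u hu w hw] with x h1 h2
    have : 0 ≤ b x := by linarith
    rw [Real.norm_eq_abs, abs_of_nonneg (by positivity)]
    gcongr
  have hloK : lo ∈ K := ⟨hlo, hle.mono fun x hx => ⟨le_rfl, hx⟩⟩
  have hint : ∀ u ∈ K, IntegrableOn (fun x => Φ x (u x)) Ω := by
    intro u hu
    refine Integrable.mono' (hbd u hu lo hloK) (hΦm u hu.1) ?_
    filter_upwards [hΦ] with x hx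
    simpa [hΦ0] using hx (u x) (lo x)
  have hintdiff : ∀ u ∈ K, ∀ w ∈ K,
      (∫ x in Ω, Φ x (u x)) - ∫ x in Ω, Φ x (w x) ≤ ∫ x in Ω, b x * |u x - w x| := by
    intro u hu w hw
    rw [← integral_sub (hint u hu) (hint w hw)]
    refine integral_mono_ae ((hint u hu).sub (hint w hw)) (hbd u hu w hw) ?_
    filter_upwards [hΦ] with x hx
    exact (le_abs_self _).trans (hx _ _)
  have hsup : ∀ u ∈ K, ∀ w ∈ K, u ⊔ w ∈ K := by
    intro u hu w hw
    refine ⟨(hu.1.isH10Pair.sup hw.1.isH10Pair).memH10 hΩ, ?_⟩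
    filter_upwards [hu.2, hw.2] with x h1 h2
    exact ⟨h1.1.trans le_sup_left, sup_le h1.2 h2.2⟩
  have hinf : ∀ u ∈ K, ∀ w ∈ K, u ⊓ w ∈ K := by
    intro u hu w hw
    refine ⟨(hu.1.isH10Pair.inf hw.1.isH10Pair).memH10 hΩ, ?_⟩
    filter_upwards [hu.2, hw.2] with x h1 h2
    exact ⟨le_inf h1.1 h2.1, inf_le_left.trans h1.2⟩
  have hmid : ∀ u ∈ K, ∀ w ∈ K, (fun x => 1 / 2 * (u x + w x)) ∈ K := by
    intro u hu w hw
    refine ⟨((hu.1.isH10Pair.add hw.1.isH10Pair).const_mul (1 / 2)).memH10 hΩ, ?_⟩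
    filter_upwards [hu.2, hw.2] with x h1 h2
    constructor <;> linarith [h1.1, h1.2, h2.1, h2.2]
  set S : (EuclideanSpace ℝ (Fin N) → ℝ) → ℝ := fun u => ∫ x in Ω, b x * |u x - lo x| with hSdef
  have hSle : ∀ u ∈ K, S u ≤ ∫ x in Ω, b x * (hi x - lo x) := by
    intro u hu
    refine integral_mono_ae (hbd u hu lo hloK) hbi ?_
    filter_upwards [hb1, hdiff u hu lo hloK] with x h1 h2
    exact mul_le_mul_of_nonneg_left h2 (by linarith)
  have hS0 : ∀ u ∈ K, 0 ≤ S u := fun u hu => integral_nonneg_of_ae <| hb1.mono fun x h1 =>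
    mul_nonneg (by linarith) (abs_nonneg _)
  have hbelow : BddBelow (energy Ω Φ '' K) := by
    refine ⟨-∫ x in Ω, b x * (hi x - lo x), ?_⟩
    rintro _ ⟨u, hu, rfl⟩
    have h1 := hintdiff u hu lo hloK
    have h2 := hSle u hu
    simp only [hΦ0, integral_zero, sub_zero] at h1
    have h3 : 0 ≤ ∫ x in Ω, ‖wgrad Ω u x‖ ^ 2 := integral_nonneg fun x => by positivity
    rw [energy]
    simp only [hSdef] at h2
    linarith
  obtain ⟨u, huK, hJ, hC⟩ := exists_minimizing_seq_of_submodular (J := energy Ω Φ) (S := S)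
    ⟨lo, hloK⟩ hsup hinf (fun u hu w hw => energy_sup_add_energy_inf_le hΩ hu.1 hw.1
      (hint u hu) (hint w hw) (hint _ (hsup u hu w hw)) (hint _ (hinf u hu w hw))) hbelow
    ⟨_, by rintro _ ⟨u, hu, rfl⟩; exact hSle u hu⟩ hS0
  set m := sInf (energy Ω Φ '' K) with hm
  have hmle : ∀ u ∈ K, m ≤ energy Ω Φ u := fun u hu => csInf_le hbelow ⟨u, hu, rfl⟩
  -- Pointwise 2 max(u, w) - u - w = |u - w|: the quantity made small by the lattice argument is the
  -- weighted L¹ distance.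
  have hSdist : ∀ u ∈ K, ∀ w ∈ K, 2 * S (u ⊔ w) - S u - S w = ∫ x in Ω, b x * |u x - w x| := by
    intro u hu w hw
    simp only [hSdef]
    have i2 : IntegrableOn (fun x => b x * |u x - lo x| + b x * |w x - lo x|) Ω :=
      (hbd u hu lo hloK).add (hbd w hw lo hloK)
    rw [sub_sub, ← integral_const_mul, ← integral_add (hbd u hu lo hloK) (hbd w hw lo hloK),
      ← integral_sub ((hbd _ (hsup u hu w hw) lo hloK).const_mul 2) i2]
    apply integral_congr_ae
    filter_upwards [hu.2, hw.2] with x h1 h2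
    simp only [Pi.sup_apply]
    rw [abs_of_nonneg (sub_nonneg.2 h1.1), abs_of_nonneg (sub_nonneg.2 h2.1)]
    rcases le_total (u x) (w x) with h | h
    · rw [sup_eq_right.2 h, abs_of_nonneg (sub_nonneg.2 h2.1), abs_of_nonpos (sub_nonpos.2 h)]
      ring
    · rw [sup_eq_left.2 h, abs_of_nonneg (sub_nonneg.2 h1.1), abs_of_nonneg (sub_nonneg.2 h)]
      ring
  -- The midpoint lies in K, so its energy is at least m. In the convexity identity the gradient
  -- distance is then bounded by the energy excesses and by the change of ∫Φ, which is Lipschitz in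
  -- the weighted L¹ distance.
  have hgrad : ∀ u ∈ K, ∀ w ∈ K, ∫ x in Ω, ‖wgrad Ω u x - wgrad Ω w x‖ ^ 2 ≤
      4 * (energy Ω Φ u - m + (energy Ω Φ w - m) + ∫ x in Ω, b x * |u x - w x|) := by
    intro u hu w hw
    have h1 := integral_norm_sub_sq_eq (Φ := Φ) hΩ hu.1 hw.1
    have h2 := hmle _ (hmid u hu w hw)
    have h3 := hintdiff u hu _ (hmid u hu w hw)
    have h4 := hintdiff w hw _ (hmid u hu w hw)
    have h5 : (∫ x in Ω, b x * |u x - 1 / 2 * (u x + w x)|) +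
        (∫ x in Ω, b x * |w x - 1 / 2 * (u x + w x)|) = ∫ x in Ω, b x * |u x - w x| := by
      rw [← integral_add (hbd u hu _ (hmid u hu w hw)) (hbd w hw _ (hmid u hu w hw))]
      congr 1
      ext x
      have e1 : u x - 1 / 2 * (u x + w x) = 1 / 2 * (u x - w x) := by ring
      have e2 : w x - 1 / 2 * (u x + w x) = -(1 / 2 * (u x - w x)) := by ring
      rw [e1, e2, abs_neg, abs_mul, abs_of_pos (by norm_num : (0 : ℝ) < 1 / 2)]
      ring
    linarith
  have hL2 : ∀ u ∈ K, ∀ w ∈ K, ∫ x in Ω, ‖u x - w x‖ ^ 2 ≤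
      M * ∫ x in Ω, b x * |u x - w x| := by
    intro u hu w hw
    rw [← integral_const_mul]
    refine integral_mono_ae (integrable_norm_sq ((mK u hu).sub (mK w hw)))
      ((hbd u hu w hw).const_mul M) ?_
    filter_upwards [hb1, hM, hdiff u hu w hw] with x h1 h2 h3
    have h4 : |u x - w x| ≤ M := h3.trans h2
    have h5 := abs_nonneg (u x - w x)
    simp only [Real.norm_eq_abs]
    calc |u x - w x| ^ 2 = |u x - w x| * (1 * |u x - w x|) := by ring
      _ ≤ M * (b x * |u x - w x|) := by gcongr; linarith
  have hgL : ∀ n, MemLp (wgrad Ω (u n)) 2 (volume.restrict Ω) :=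
    fun n => (huK n).1.isH10Pair.memLp_grad
  have hJm : ∀ ε > 0, ∃ n₀ : ℕ, ∀ n ≥ n₀, energy Ω Φ (u n) - m < ε := by
    intro ε hε
    obtain ⟨n₀, h⟩ := eventually_atTop.1 (hJ.eventually (gt_mem_nhds (lt_add_of_pos_right m hε)))
    exact ⟨n₀, fun n hn => by linarith [h n hn]⟩
  have c1 : CauchySeq fun n => (mK _ (huK n)).toLp (u n) := by
    rw [Metric.cauchySeq_iff]
    intro ε hε
    obtain ⟨n₀, h⟩ := hC (ε ^ 2 / (|M| + 1)) (by positivity)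
    refine ⟨n₀, fun k hk l hl => ?_⟩
    have h1 := h k hk l hl
    rw [hSdist _ (huK k) _ (huK l)] at h1
    have h2 := hL2 _ (huK k) _ (huK l)
    have h0 : 0 ≤ ∫ x in Ω, b x * |u k x - u l x| :=
      integral_nonneg_of_ae <| hb1.mono fun x h1 => mul_nonneg (by linarith) (abs_nonneg _)
    have h3 := norm_toLp_two_sq ((mK _ (huK k)).sub (mK _ (huK l)))
    rw [dist_eq_norm, ← MemLp.toLp_sub]
    refine lt_of_pow_lt_pow_left₀ 2 hε.le (h3 ▸ ?_)
    simp only [Pi.sub_apply]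
    rw [lt_div_iff₀ (by positivity)] at h1
    nlinarith [le_abs_self M]
  have c2 : CauchySeq fun n => (hgL n).toLp (wgrad Ω (u n)) := by
    rw [Metric.cauchySeq_iff]
    intro ε hε
    obtain ⟨n₀, h⟩ := hC (ε ^ 2 / 16) (by positivity)
    obtain ⟨n₁, h'⟩ := hJm (ε ^ 2 / 16) (by positivity)
    refine ⟨max n₀ n₁, fun k hk l hl => ?_⟩
    have h1 := h k (le_of_max_le_left hk) l (le_of_max_le_left hl)
    rw [hSdist _ (huK k) _ (huK l)] at h1
    have h2 := hgrad _ (huK k) _ (huK l)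
    have h4 := h' k (le_of_max_le_right hk)
    have h5 := h' l (le_of_max_le_right hl)
    have h3 := norm_toLp_two_sq ((hgL k).sub (hgL l))
    rw [dist_eq_norm, ← MemLp.toLp_sub]
    refine lt_of_pow_lt_pow_left₀ 2 hε.le (h3 ▸ ?_)
    simp only [Pi.sub_apply]
    have : 0 < ε ^ 2 := by positivity
    linarith
  obtain ⟨U, hU⟩ := cauchySeq_tendsto_of_complete c1
  obtain ⟨FF, hFF⟩ := cauchySeq_tendsto_of_complete c2
  have hpair : IsH10Pair Ω U FF := by
    refine ⟨Lp.memLp U, Lp.memLp FF, ?_⟩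
    rw [Lp.toLp_coeFn, Lp.toLp_coeFn]
    exact (testPairs Ω).isClosed_topologicalClosure.mem_of_tendsto (hU.prodMk_nhds hFF)
      (Eventually.of_forall fun n => (huK n).1.isH10Pair.2.2)
  have hUe : Tendsto (fun n => eLpNorm (fun x => u n x - U x) 2 (volume.restrict Ω)) atTop
      (𝓝 0) := by
    refine (Lp.tendsto_Lp_iff_tendsto_eLpNorm'' u (fun n => mK _ (huK n)) U (Lp.memLp U)).1 ?_
    rwa [Lp.toLp_coeFn]
  obtain ⟨ns, hns, hae⟩ := exists_subseq_ae_of_tendsto_eLpNorm_two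
    (fun n => (mK _ (huK n)).1) (Lp.memLp U).1 hUe
  have hUK : (U : EuclideanSpace ℝ (Fin N) → ℝ) ∈ K := by
    refine ⟨hpair.memH10 hΩ, ?_⟩
    filter_upwards [hae, ae_all_iff.2 fun n => (huK (ns n)).2] with x h1 h2
    exact ⟨ge_of_tendsto' h1 fun n => (h2 n).1, le_of_tendsto' h1 fun n => (h2 n).2⟩
  -- The gradients converge strongly, so the energy converges and no semicontinuity argument is
  -- required.
  have hJU : Tendsto (fun n => energy Ω Φ (u (ns n))) atTop (𝓝 (energy Ω Φ U)) := by
    rw [hpair.energy_eq hΩ]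
    unfold energy
    refine Tendsto.sub (Tendsto.const_mul _ ?_) ?_
    · have := ((continuous_norm.tendsto _).comp (hFF.comp hns.tendsto_atTop)).pow 2
      have e : ∫ x in Ω, ‖FF x‖ ^ 2 = ‖FF‖ ^ 2 := by
        have := norm_toLp_two_sq (Lp.memLp FF)
        rw [Lp.toLp_coeFn] at this
        exact this.symm
      rw [e]
      refine this.congr fun n => ?_
      simp only [Function.comp_apply]
      rw [norm_toLp_two_sq]
    · refine tendsto_integral_of_dominated_convergence (fun x => b x * (hi x - lo x))
        (fun n => hΦm _ (huK _).1) hbi (fun n => ?_) ?_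
      · filter_upwards [hΦ, hb1, hdiff _ (huK (ns n)) lo hloK] with x h1 h2 h3
        have := h1 (u (ns n) x) (lo x)
        rw [hΦ0, sub_zero] at this
        exact this.trans (mul_le_mul_of_nonneg_left h3 (by linarith))
      · filter_upwards [hΦ, hae] with x h1 h2
        rw [tendsto_iff_dist_tendsto_zero] at h2 ⊢
        have := h2.const_mul (b x)
        rw [mul_zero] at this
        exact squeeze_zero (fun _ => dist_nonneg) (fun n => h1 _ _) this
  have hmU : energy Ω Φ U = m := tendsto_nhds_unique hJU (hJ.comp hns.tendsto_atTop)
  exact ⟨U, hUK, fun w hw => by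
    simp only [mem_ofPred_eq]
    rw [hmU]
    exact hmle w hw⟩

end

end SingQuasi

namespace SingQuasi

/-! ### The truncated problem -/

/-- The right-hand side `a(x) g(t)^(-γ) g'(t) + lam g(t)^p g'(t)`. -/
noncomputable def reaction {N : ℕ} (a : EuclideanSpace ℝ (Fin N) → ℝ) (γ p lam : ℝ)
    (x : EuclideanSpace ℝ (Fin N)) (t : ℝ) : ℝ :=
  a x * singNonlin γ t + lam * powNonlin p t

/-- The primitive, vanishing at `vlo x`, of the right-hand side frozen outside
`[vlo x, vhi x]`. -/
noncomputable def reactionPrim {N : ℕ} (a : EuclideanSpace ℝ (Fin N) → ℝ) (γ p lam : ℝ)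
    (vlo vhi : EuclideanSpace ℝ (Fin N) → ℝ) (x : EuclideanSpace ℝ (Fin N)) (t : ℝ) : ℝ :=
  a x * clampPrim (singNonlin γ) (vlo x) (vhi x) t +
    lam * clampPrim (powNonlin p) (vlo x) (vhi x) t

/-- An ordered pair of a subsolution and a supersolution, the latter bounded by `M`. -/
structure IsOrderedPair {N : ℕ} (Ω : Set (EuclideanSpace ℝ (Fin N)))
    (a : EuclideanSpace ℝ (Fin N) → ℝ) (γ p lam : ℝ)
    (vlo vhi : EuclideanSpace ℝ (Fin N) → ℝ) (M : ℝ) : Prop where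
  isOpen : IsOpen Ω
  finite : IsFiniteMeasure (volume.restrict Ω)
  meas : AEMeasurable a (volume.restrict Ω)
  a_pos : ∀ᵐ x ∂volume.restrict Ω, 0 < a x
  gamma_pos : 0 < γ
  p_nonneg : 0 ≤ p
  lam_nonneg : 0 ≤ lam
  sub : IsSubsolution Ω a γ p lam vlo
  super : IsSupersolution Ω a γ p lam vhi
  le : ∀ᵐ x ∂volume.restrict Ω, vlo x ≤ vhi x
  M_nonneg : 0 ≤ M
  le_M : ∀ᵐ x ∂volume.restrict Ω, vhi x ≤ M

variable {N : ℕ} {Ω : Set (EuclideanSpace ℝ (Fin N))}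
  {a : EuclideanSpace ℝ (Fin N) → ℝ} {γ p lam : ℝ}
  {vlo vhi u v z ψ : EuclideanSpace ℝ (Fin N) → ℝ} {M : ℝ}

/-! ### Pointwise bounds for the truncated reaction. -/

section Pointwise

variable {x : EuclideanSpace ℝ (Fin N)} {s t : ℝ}

theorem continuousOn_singNonlin_Icc {lo hi : ℝ} (hlo : 0 < lo) :
    ContinuousOn (singNonlin γ) (Icc lo hi) :=
  (continuousOn_singNonlin γ).mono fun _ hx => hlo.trans_le hx.1

theorem abs_clampPrim_singNonlin_sub_le (hγ : 0 < γ) {lo hi : ℝ} (hlo : 0 < lo) (hle : lo ≤ hi) :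
    |clampPrim (singNonlin γ) lo hi t - clampPrim (singNonlin γ) lo hi s| ≤
      singNonlin γ lo * |t - s| := by
  refine abs_clampPrim_sub_le (continuousOn_singNonlin_Icc hlo) hle fun r hr => ?_
  rw [abs_of_pos (singNonlin_pos (hlo.trans_le hr.1))]
  exact singNonlin_antitoneOn hγ hlo (hlo.trans_le hr.1) hr.1

theorem abs_clampPrim_powNonlin_sub_le (hp : 0 ≤ p) {lo hi : ℝ} (hlo : 0 ≤ lo) (hle : lo ≤ hi)
    (hM : hi ≤ M) :
    |clampPrim (powNonlin p) lo hi t - clampPrim (powNonlin p) lo hi s| ≤ M ^ p * |t - s| := by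
  refine abs_clampPrim_sub_le (continuous_powNonlin hp).continuousOn hle fun r hr => ?_
  rw [abs_of_nonneg (powNonlin_nonneg (hlo.trans hr.1))]
  exact powNonlin_le hp (hlo.trans hr.1) (hr.2.trans hM)

theorem reactionPrim_self : reactionPrim a γ p lam vlo vhi x (vlo x) = 0 := by
  simp [reactionPrim]

theorem hasDerivAt_reactionPrim (hp : 0 ≤ p) (hlo : 0 < vlo x) (hle : vlo x ≤ vhi x) :
    HasDerivAt (reactionPrim a γ p lam vlo vhi x)
      (reaction a γ p lam x (max (vlo x) (min t (vhi x)))) t :=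
  ((hasDerivAt_clampPrim (continuousOn_singNonlin_Icc hlo) hle t).const_mul (a x)).add
    ((hasDerivAt_clampPrim (continuous_powNonlin hp).continuousOn hle t).const_mul lam)

/-- Outside [vlo x, vhi x] the reaction is frozen and its primitive affine, so the tangent
inequality used in truncation holds with equality. -/
theorem reactionPrim_sub_clamp (hp : 0 ≤ p) (hlo : 0 < vlo x) (hle : vlo x ≤ vhi x) :
    reactionPrim a γ p lam vlo vhi x t -
        reactionPrim a γ p lam vlo vhi x (max (vlo x) (min t (vhi x))) =
      reaction a γ p lam x (vhi x) * max (t - vhi x) 0 -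
        reaction a γ p lam x (vlo x) * max (vlo x - t) 0 := by
  have h1 := clampPrim_sub_clamp (t := t) (continuousOn_singNonlin_Icc (γ := γ) hlo) hle
  have h2 := clampPrim_sub_clamp (t := t) (continuous_powNonlin hp).continuousOn hle
  simp only [reactionPrim, reaction]
  linear_combination a x * h1 + lam * h2

/-- The summand 1 makes the Lipschitz constant at least 1, as `exists_isMinOn_energy` demands of its
weight. -/
theorem abs_reactionPrim_sub_le (hγ : 0 < γ) (hp : 0 ≤ p) (hlam : 0 ≤ lam) (ha : 0 ≤ a x)
    (hlo : 0 < vlo x) (hle : vlo x ≤ vhi x) (hM : vhi x ≤ M) :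
    |reactionPrim a γ p lam vlo vhi x t - reactionPrim a γ p lam vlo vhi x s| ≤
      (a x * singNonlin γ (vlo x) + lam * M ^ p + 1) * |t - s| := by
  have h1 := abs_clampPrim_singNonlin_sub_le (t := t) (s := s) hγ hlo hle
  have h2 := abs_clampPrim_powNonlin_sub_le (t := t) (s := s) hp hlo.le hle hM
  have e : reactionPrim a γ p lam vlo vhi x t - reactionPrim a γ p lam vlo vhi x s =
      a x * (clampPrim (singNonlin γ) (vlo x) (vhi x) t -
        clampPrim (singNonlin γ) (vlo x) (vhi x) s) +
      lam * (clampPrim (powNonlin p) (vlo x) (vhi x) t -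
        clampPrim (powNonlin p) (vlo x) (vhi x) s) := by
    simp only [reactionPrim]
    ring
  rw [e]
  calc _ ≤ a x * (singNonlin γ (vlo x) * |t - s|) + lam * (M ^ p * |t - s|) := by
        refine (abs_add_le _ _).trans ?_
        rw [abs_mul, abs_mul, abs_of_nonneg ha, abs_of_nonneg hlam]
        gcongr
    _ ≤ _ := by nlinarith [abs_nonneg (t - s)]

end Pointwise

theorem MemH10.memLp (h : MemH10 Ω u) : MemLp u 2 (volume.restrict Ω) := h.1.1

/-! ### Truncation, minimisation and the weak equation for an ordered pair. -/

namespace IsOrderedPair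

theorem measurable_lo (h : IsOrderedPair Ω a γ p lam vlo vhi M) :
    AEMeasurable vlo (volume.restrict Ω) :=
  h.sub.memH10.memLp.1.aemeasurable

theorem measurable_hi (h : IsOrderedPair Ω a γ p lam vlo vhi M) :
    AEMeasurable vhi (volume.restrict Ω) :=
  h.super.memH10.memLp.1.aemeasurable

theorem aestronglyMeasurable_sing (h : IsOrderedPair Ω a γ p lam vlo vhi M)
    (hu : AEMeasurable u (volume.restrict Ω)) :
    AEStronglyMeasurable (fun x => a x * singNonlin γ (u x)) (volume.restrict Ω) :=
  (h.meas.mul ((measurable_singNonlin γ).comp_aemeasurable hu)).aestronglyMeasurable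

theorem aemeasurable_clampPrim (h : IsOrderedPair Ω a γ p lam vlo vhi M) {f : ℝ → ℝ}
    (hf : Measurable f) (hu : AEMeasurable u (volume.restrict Ω)) :
    AEMeasurable (fun x => clampPrim f (vlo x) (vhi x) (u x)) (volume.restrict Ω) :=
  (measurable_clampPrim hf).comp_aemeasurable
    (h.measurable_lo.prodMk (h.measurable_hi.prodMk hu))

/-- The definition of a subsolution gives integrability for nonnegative test functions only; |ψ| is
one of these, and integrability depends only on absolute values. -/
theorem integrable_sing (h : IsOrderedPair Ω a γ p lam vlo vhi M) (hψ : MemH10 Ω ψ) :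
    IntegrableOn (fun x => a x * singNonlin γ (vlo x) * ψ x) Ω := by
  have h1 := h.sub.integrable_sing _ (hψ.isH10Pair.abs.memH10 h.isOpen)
    (Eventually.of_forall fun x => abs_nonneg _)
  refine Integrable.mono h1 ((h.aestronglyMeasurable_sing h.measurable_lo).mul hψ.memLp.1) ?_
  refine Eventually.of_forall fun x => ?_
  simp only [singNonlin, norm_mul, Real.norm_eq_abs, abs_abs]
  exact le_of_eq (by ring)

/-- The Lipschitz constant of the truncated primitives is integrable against `H¹₀(Ω)`. -/
theorem integrable_lipschitz (h : IsOrderedPair Ω a γ p lam vlo vhi M) (hψ : MemH10 Ω ψ) :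
    IntegrableOn (fun x => (a x * singNonlin γ (vlo x) + lam * M ^ p + 1) * ψ x) Ω := by
  have := h.finite
  have h1 := h.integrable_sing hψ
  have h2 : Integrable ψ (volume.restrict Ω) := hψ.memLp.integrable (by norm_num)
  refine (h1.add (h2.const_mul (lam * M ^ p + 1))).congr (Eventually.of_forall fun x => ?_)
  simp only [Pi.add_apply]
  ring

theorem ae_bounds (h : IsOrderedPair Ω a γ p lam vlo vhi M) :
    ∀ᵐ x ∂volume.restrict Ω, 0 < a x ∧ 0 < vlo x ∧ vlo x ≤ vhi x ∧ vhi x ≤ M := by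
  filter_upwards [h.a_pos, h.sub.pos, h.le, h.le_M] with x h1 h2 h3 h4
  exact ⟨h1, h2, h3, h4⟩

theorem aestronglyMeasurable_reactionPrim (h : IsOrderedPair Ω a γ p lam vlo vhi M)
    (hu : AEMeasurable u (volume.restrict Ω)) :
    AEStronglyMeasurable (fun x => reactionPrim a γ p lam vlo vhi x (u x))
      (volume.restrict Ω) :=
  ((h.meas.mul (h.aemeasurable_clampPrim (measurable_singNonlin γ) hu)).add
    ((h.aemeasurable_clampPrim (continuous_powNonlin h.p_nonneg).measurable
      hu).const_mul lam)).aestronglyMeasurable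

theorem integrable_sing_clampPrim (h : IsOrderedPair Ω a γ p lam vlo vhi M) (hu : MemH10 Ω u) :
    IntegrableOn (fun x => a x * clampPrim (singNonlin γ) (vlo x) (vhi x) (u x)) Ω := by
  have h1 := h.integrable_sing ((hu.isH10Pair.sub h.sub.memH10.isH10Pair).memH10 h.isOpen)
  refine Integrable.mono h1 (h.meas.mul (h.aemeasurable_clampPrim (measurable_singNonlin γ)
    hu.memLp.1.aemeasurable)).aestronglyMeasurable ?_
  filter_upwards [h.ae_bounds] with x ⟨h1, h2, h3, h4⟩
  have := abs_clampPrim_singNonlin_sub_le (t := u x) (s := vlo x) h.gamma_pos h2 h3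
  rw [clampPrim_self, sub_zero] at this
  rw [norm_mul, norm_mul, norm_mul, mul_assoc, Real.norm_eq_abs (singNonlin _ _),
    abs_of_pos (singNonlin_pos h2)]
  exact mul_le_mul_of_nonneg_left this (norm_nonneg _)

theorem integrable_pow_clampPrim (h : IsOrderedPair Ω a γ p lam vlo vhi M) (hu : MemH10 Ω u) :
    IntegrableOn (fun x => clampPrim (powNonlin p) (vlo x) (vhi x) (u x)) Ω := by
  have := h.finite
  have h1 : Integrable (fun x => M ^ p * |u x - vlo x|) (volume.restrict Ω) :=
    ((hu.memLp.sub h.sub.memH10.memLp).integrable (by norm_num)).norm.const_mul _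
  refine h1.mono' (h.aemeasurable_clampPrim (continuous_powNonlin h.p_nonneg).measurable
    hu.memLp.1.aemeasurable).aestronglyMeasurable ?_
  filter_upwards [h.ae_bounds] with x ⟨h1, h2, h3, h4⟩
  have := abs_clampPrim_powNonlin_sub_le (t := u x) (s := vlo x) h.p_nonneg h2.le h3 h4
  rwa [clampPrim_self, sub_zero] at this

theorem integrable_reactionPrim (h : IsOrderedPair Ω a γ p lam vlo vhi M) (hu : MemH10 Ω u) :
    IntegrableOn (fun x => reactionPrim a γ p lam vlo vhi x (u x)) Ω :=
  (h.integrable_sing_clampPrim hu).add ((h.integrable_pow_clampPrim hu).const_mul lam)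

theorem sub_weak (h : IsOrderedPair Ω a γ p lam vlo vhi M) (hψ : MemH10 Ω ψ)
    (hψ0 : ∀ᵐ x ∂volume.restrict Ω, 0 ≤ ψ x) :
    IntegrableOn (fun x => reaction a γ p lam x (vlo x) * ψ x) Ω ∧
    ∫ x in Ω, inner ℝ (wgrad Ω vlo x) (wgrad Ω ψ x) ≤
      ∫ x in Ω, reaction a γ p lam x (vlo x) * ψ x := by
  have h1 := h.sub.integrable_sing ψ hψ hψ0
  have h2 := (h.sub.integrable_pow ψ hψ hψ0).const_mul lam
  have e : (fun x => reaction a γ p lam x (vlo x) * ψ x) = fun x =>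
      a x * g (vlo x) ^ (-γ) * deriv g (vlo x) * ψ x +
        lam * (g (vlo x) ^ p * deriv g (vlo x) * ψ x) := by
    ext x
    simp only [reaction, singNonlin, powNonlin]
    ring
  rw [e]
  refine ⟨h1.add h2, ?_⟩
  rw [integral_add h1 h2, integral_const_mul]
  exact h.sub.weak ψ hψ hψ0

theorem super_weak (h : IsOrderedPair Ω a γ p lam vlo vhi M) (hψ : MemH10 Ω ψ)
    (hψ0 : ∀ᵐ x ∂volume.restrict Ω, 0 ≤ ψ x) :
    IntegrableOn (fun x => reaction a γ p lam x (vhi x) * ψ x) Ω ∧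
    ∫ x in Ω, reaction a γ p lam x (vhi x) * ψ x ≤
      ∫ x in Ω, inner ℝ (wgrad Ω vhi x) (wgrad Ω ψ x) := by
  have h1 := h.super.integrable_sing ψ hψ hψ0
  have h2 := (h.super.integrable_pow ψ hψ hψ0).const_mul lam
  have e : (fun x => reaction a γ p lam x (vhi x) * ψ x) = fun x =>
      a x * g (vhi x) ^ (-γ) * deriv g (vhi x) * ψ x +
        lam * (g (vhi x) ^ p * deriv g (vhi x) * ψ x) := by
    ext x
    simp only [reaction, singNonlin, powNonlin]
    ring
  rw [e]
  refine ⟨h1.add h2, ?_⟩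
  rw [integral_add h1 h2, integral_const_mul]
  exact h.super.weak ψ hψ hψ0

open Classical in
/-- Truncation between `vlo` and `vhi` stays in `H¹₀`. -/
theorem isH10Pair_clamp (h : IsOrderedPair Ω a γ p lam vlo vhi M) (hz : MemH10 Ω z) :
    IsH10Pair Ω (fun x => max (vlo x) (min (z x) (vhi x)))
      (fun x => wgrad Ω z x - (if 0 < z x - vhi x then wgrad Ω z x - wgrad Ω vhi x else 0) +
        (if 0 < vlo x - z x then wgrad Ω vlo x - wgrad Ω z x else 0)) := by
  have hz := hz.isH10Pair
  have hlo := h.sub.memH10.isH10Pair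
  have hhi := h.super.memH10.isH10Pair
  -- The truncation is z - (z - vhi)⁺ + (vlo - z)⁺, so only positive parts are involved.
  refine ((hz.sub ((hz.sub hhi).posPart h.isOpen)).add ((hlo.sub hz).posPart h.isOpen)).congr_ae
    ?_ (ae_eq_refl _)
  filter_upwards [h.le] with x hx
  rcases le_total (z x) (vlo x) with h1 | h1
  · rw [min_eq_left (h1.trans hx), max_eq_left h1, max_eq_right (by linarith),
      max_eq_left (by linarith)]
    ring
  rcases le_total (z x) (vhi x) with h2 | h2
  · rw [min_eq_left h2, max_eq_right h1, max_eq_right (by linarith), max_eq_right (by linarith)]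
    ring
  · rw [min_eq_right h2, max_eq_right hx, max_eq_left (by linarith), max_eq_right (by linarith)]
    ring

theorem clamp_mem_between (h : IsOrderedPair Ω a γ p lam vlo vhi M) (hz : MemH10 Ω z) :
    (fun x => max (vlo x) (min (z x) (vhi x))) ∈ between Ω vlo vhi :=
  ⟨(h.isH10Pair_clamp hz).memH10 h.isOpen, h.le.mono fun _ hx =>
    ⟨le_max_left _ _, max_le hx (min_le_right _ _)⟩⟩

/-- Truncation between a subsolution and a supersolution does not increase the energy. -/
theorem energy_clamp_le (h : IsOrderedPair Ω a γ p lam vlo vhi M) (hz : MemH10 Ω z)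
    {Φ : EuclideanSpace ℝ (Fin N) → ℝ → ℝ} (iz : IntegrableOn (fun x => Φ x (z x)) Ω)
    (iw : IntegrableOn (fun x => Φ x (max (vlo x) (min (z x) (vhi x)))) Ω)
    (hΦ : ∀ᵐ x ∂volume.restrict Ω, Φ x (z x) - Φ x (max (vlo x) (min (z x) (vhi x))) ≤
      reaction a γ p lam x (vhi x) * max (z x - vhi x) 0 -
        reaction a γ p lam x (vlo x) * max (vlo x - z x) 0) :
    energy Ω Φ (fun x => max (vlo x) (min (z x) (vhi x))) ≤ energy Ω Φ z := by
  classical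
  have hw := h.isH10Pair_clamp hz
  have hz' := hz.isH10Pair
  have hlo := h.sub.memH10.isH10Pair
  have hhi := h.super.memH10.isH10Pair
  have h1 := (hz'.sub hhi).posPart h.isOpen
  have h2 := (hlo.sub hz').posPart h.isOpen
  obtain ⟨i1, w1⟩ := h.super_weak (h1.memH10 h.isOpen)
    (Eventually.of_forall fun x => le_max_right _ _)
  obtain ⟨i2, w2⟩ := h.sub_weak (h2.memH10 h.isOpen)
    (Eventually.of_forall fun x => le_max_right _ _)
  rw [hw.energy_eq h.isOpen, energy]
  have s1 := integral_mono_ae (iz.sub iw) (i1.sub i2) hΦ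
  simp only [Pi.sub_apply] at s1
  rw [integral_sub iz iw, integral_sub i1 i2] at s1
  have iP := integrable_inner_of_memLp hhi.memLp_grad h1.memLp_grad
  have iQ := integrable_inner_of_memLp hlo.memLp_grad h2.memLp_grad
  have eP := integral_congr_ae (μ := volume.restrict Ω) ((h1.wgrad_ae_eq h.isOpen).mono
    fun x hx => show inner ℝ (wgrad Ω vhi x) (wgrad Ω _ x) = inner ℝ (wgrad Ω vhi x) _ by rw [hx])
  have eQ := integral_congr_ae (μ := volume.restrict Ω) ((h2.wgrad_ae_eq h.isOpen).mono
    fun x hx => show inner ℝ (wgrad Ω vlo x) (wgrad Ω _ x) = inner ℝ (wgrad Ω vlo x) _ by rw [hx])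
  rw [eP] at w1
  rw [eQ] at w2
  have iz2 := (integrable_norm_sq hz'.memLp_grad).const_mul (1 / 2)
  have iw2 := (integrable_norm_sq hw.memLp_grad).const_mul (1 / 2)
  -- With P = (z - vhi)⁺, Q = (vlo - z)⁺ and w the truncation, the pointwise claim is ∇vhi·∇P -
  -- ∇vlo·∇Q ≤ ½|∇z|² - ½|∇w|². Where ∇P or ∇Q is nonzero, ∇w is ∇vhi or ∇vlo, and the claim is the
  -- tangent inequality `key` for ½|·|².
  have s2 := integral_mono_ae (iP.sub iQ) (iz2.sub iw2) ?_
  · simp only [Pi.sub_apply] at s2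
    rw [integral_sub iP iQ, integral_sub iz2 iw2, integral_const_mul, integral_const_mul] at s2
    linarith
  · filter_upwards [h.le] with x hx
    simp only [Pi.sub_apply]
    have key : ∀ F G : EuclideanSpace ℝ (Fin N),
        inner ℝ G (F - G) ≤ 1 / 2 * ‖F‖ ^ 2 - 1 / 2 * ‖G‖ ^ 2 := by
      intro F G
      have := norm_sub_sq_real F G
      rw [inner_sub_right, real_inner_self_eq_norm_sq, real_inner_comm]
      nlinarith [sq_nonneg ‖F - G‖]
    by_cases c1 : 0 < z x - vhi x
    · have c2 : ¬ 0 < vlo x - z x := by linarith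
      simp only [if_pos c1, if_neg c2, inner_zero_right, sub_zero, add_zero, sub_sub_cancel]
      exact key _ _
    · by_cases c2 : 0 < vlo x - z x
      · simp only [if_neg c1, if_pos c2, inner_zero_right, sub_zero, zero_sub, add_sub_cancel]
        have := key (wgrad Ω z x) (wgrad Ω vlo x)
        rw [← inner_neg_right, neg_sub]
        exact this
      · simp only [if_neg c1, if_neg c2, inner_zero_right, sub_zero, add_zero, sub_self, le_refl]

/-- The truncated energy has a minimiser over `H¹₀(Ω)`, which lies between `vlo` and `vhi`. -/
theorem exists_isMinOn (h : IsOrderedPair Ω a γ p lam vlo vhi M) :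
    ∃ v ∈ between Ω vlo vhi,
      IsMinOn (energy Ω (reactionPrim a γ p lam vlo vhi)) {z | MemH10 Ω z} v := by
  have hex : ∃ v ∈ between Ω vlo vhi,
      IsMinOn (energy Ω (reactionPrim a γ p lam vlo vhi)) (between Ω vlo vhi) v := by
    refine exists_isMinOn_energy
      (b := fun x => a x * singNonlin γ (vlo x) + lam * M ^ p + 1) (M := M) h.isOpen h.sub.memH10
      h.le ?_ ?_ ?_
      (h.integrable_lipschitz ((h.super.memH10.isH10Pair.sub h.sub.memH10.isH10Pair).memH10
        h.isOpen)) (fun u hu => h.aestronglyMeasurable_reactionPrim hu.memLp.1.aemeasurable)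
      (fun x => reactionPrim_self) ?_
    · filter_upwards [h.ae_bounds] with x ⟨h1, h2, h3, h4⟩
      linarith
    · exact ((h.aestronglyMeasurable_sing h.measurable_lo).add_const _).add_const _
    · filter_upwards [h.ae_bounds] with x ⟨h1, h2, h3, h4⟩
      have := mul_pos h1 (singNonlin_pos (γ := γ) h2)
      have := mul_nonneg h.lam_nonneg (Real.rpow_nonneg h.M_nonneg p)
      linarith
    · filter_upwards [h.ae_bounds] with x ⟨h1, h2, h3, h4⟩ s t
      exact abs_reactionPrim_sub_le h.gamma_pos h.p_nonneg h.lam_nonneg h1.le h2 h3 h4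
  obtain ⟨v, hv, hmin⟩ := hex
  refine ⟨v, hv, fun z hz => ?_⟩
  -- Any competitor in H¹₀ may be truncated into the order interval without raising the energy.
  refine (isMinOn_iff.1 hmin _ (h.clamp_mem_between hz)).trans
    (h.energy_clamp_le hz (h.integrable_reactionPrim hz)
    (h.integrable_reactionPrim (h.clamp_mem_between hz).1) ?_)
  filter_upwards [h.ae_bounds] with x ⟨h1, h2, h3, h4⟩
  exact (reactionPrim_sub_clamp h.p_nonneg h2 h3).le

theorem integrable_sing_of_between (h : IsOrderedPair Ω a γ p lam vlo vhi M)
    (hv : v ∈ between Ω vlo vhi) (hψ : MemH10 Ω ψ) :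
    IntegrableOn (fun x => a x * singNonlin γ (v x) * ψ x) Ω := by
  refine Integrable.mono (h.integrable_sing hψ)
    ((h.aestronglyMeasurable_sing hv.1.memLp.1.aemeasurable).mul hψ.memLp.1) ?_
  filter_upwards [h.ae_bounds, hv.2] with x ⟨h1, h2, h3, h4⟩ h5
  have h6 := h2.trans_le h5.1
  rw [norm_mul, norm_mul, norm_mul, norm_mul, Real.norm_eq_abs (singNonlin _ _),
    Real.norm_eq_abs (singNonlin _ _), abs_of_pos (singNonlin_pos h2),
    abs_of_pos (singNonlin_pos h6)]
  gcongr
  exact singNonlin_antitoneOn h.gamma_pos h2 h6 h5.1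

theorem integrable_pow_of_between (h : IsOrderedPair Ω a γ p lam vlo vhi M)
    (hv : v ∈ between Ω vlo vhi) (hψ : MemH10 Ω ψ) :
    IntegrableOn (fun x => powNonlin p (v x) * ψ x) Ω := by
  have := h.finite
  have i : Integrable (fun x => M ^ p * ψ x) (volume.restrict Ω) :=
    (hψ.memLp.integrable (by norm_num)).const_mul _
  refine i.mono (((continuous_powNonlin h.p_nonneg).comp_aestronglyMeasurable hv.1.memLp.1).mul
    hψ.memLp.1) ?_
  filter_upwards [h.ae_bounds, hv.2] with x ⟨h1, h2, h3, h4⟩ h5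
  have h6 := h2.trans_le h5.1
  rw [norm_mul, norm_mul, Real.norm_eq_abs (powNonlin _ _), abs_of_nonneg (powNonlin_nonneg h6.le),
    Real.norm_eq_abs (M ^ p), abs_of_nonneg (Real.rpow_nonneg h.M_nonneg p)]
  gcongr
  exact powNonlin_le h.p_nonneg h6.le (h5.2.trans h4)

/-- The one-sided derivative of the energy at the minimiser in the direction ψ is nonnegative. The
difference quotients of the lower-order term are dominated by the Lipschitz constant times |ψ|,
which is integrable. -/
theorem integral_reaction_le (h : IsOrderedPair Ω a γ p lam vlo vhi M)
    (hv : v ∈ between Ω vlo vhi)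
    (hmin : IsMinOn (energy Ω (reactionPrim a γ p lam vlo vhi)) {z | MemH10 Ω z} v)
    (hψ : MemH10 Ω ψ) :
    ∫ x in Ω, reaction a γ p lam x (v x) * ψ x ≤
      ∫ x in Ω, inner ℝ (wgrad Ω v x) (wgrad Ω ψ x) := by
  set Φ := reactionPrim a γ p lam vlo vhi with hΦ
  have pv := hv.1.isH10Pair
  have pψ := hψ.isH10Pair
  have hpair : ∀ ε : ℝ, IsH10Pair Ω (fun x => v x + ε * ψ x)
      (fun x => wgrad Ω v x + ε • wgrad Ω ψ x) := fun ε => pv.add (pψ.const_mul ε)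
  have iΦv := h.integrable_reactionPrim hv.1
  have hquot : ∀ ε : ℝ, 0 < ε →
      ∫ x in Ω, ε⁻¹ • (Φ x (v x + ε * ψ x) - Φ x (v x)) ≤
        (∫ x in Ω, inner ℝ (wgrad Ω v x) (wgrad Ω ψ x)) +
          ε / 2 * ∫ x in Ω, ‖wgrad Ω ψ x‖ ^ 2 := by
    intro ε hε
    have hm := ((hpair ε).memH10 h.isOpen)
    have h1 : energy Ω Φ v ≤ energy Ω Φ (fun x => v x + ε * ψ x) := hmin hm
    rw [(hpair ε).energy_eq h.isOpen, energy] at h1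
    have e1 : ∫ x in Ω, ‖wgrad Ω v x + ε • wgrad Ω ψ x‖ ^ 2 =
        (∫ x in Ω, ‖wgrad Ω v x‖ ^ 2) +
          (2 * ε * (∫ x in Ω, inner ℝ (wgrad Ω v x) (wgrad Ω ψ x)) +
          ε ^ 2 * ∫ x in Ω, ‖wgrad Ω ψ x‖ ^ 2) := by
      have j2 := (integrable_inner_of_memLp pv.memLp_grad pψ.memLp_grad).const_mul (2 * ε)
      have j3 := (integrable_norm_sq pψ.memLp_grad).const_mul (ε ^ 2)
      have j4 : IntegrableOn (fun x => 2 * ε * inner ℝ (wgrad Ω v x) (wgrad Ω ψ x) +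
        ε ^ 2 * ‖wgrad Ω ψ x‖ ^ 2) Ω := j2.add j3
      rw [← integral_const_mul, ← integral_const_mul, ← integral_add j2 j3,
        ← integral_add (integrable_norm_sq pv.memLp_grad) j4]
      congr 1
      ext x
      rw [norm_add_sq_real, inner_smul_right, norm_smul, mul_pow, Real.norm_eq_abs, sq_abs]
      ring
    have e2 := integral_sub (h.integrable_reactionPrim hm) iΦv
    rw [integral_smul, e2, smul_eq_mul, inv_mul_le_iff₀ hε]
    rw [e1] at h1
    linarith
  have hlim : Tendsto (fun ε : ℝ => ∫ x in Ω, ε⁻¹ • (Φ x (v x + ε * ψ x) - Φ x (v x)))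
      (𝓝[>] 0) (𝓝 (∫ x in Ω, reaction a γ p lam x (v x) * ψ x)) := by
    refine tendsto_integral_filter_of_dominated_convergence
      (fun x => (a x * singNonlin γ (vlo x) + lam * M ^ p + 1) * |ψ x|) ?_ ?_
      (h.integrable_lipschitz (pψ.abs.memH10 h.isOpen)) ?_
    · exact Eventually.of_forall fun ε => (((h.integrable_reactionPrim
        ((hpair ε).memH10 h.isOpen)).sub iΦv).1.const_smul ε⁻¹)
    · filter_upwards [self_mem_nhdsWithin] with ε hε
      filter_upwards [h.ae_bounds] with x ⟨h1, h2, h3, h4⟩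
      have hε' : 0 < ε := hε
      have := abs_reactionPrim_sub_le (t := v x + ε * ψ x) (s := v x) h.gamma_pos h.p_nonneg
        h.lam_nonneg h1.le h2 h3 h4
      rw [add_sub_cancel_left, abs_mul, abs_of_pos hε'] at this
      rw [norm_smul, norm_inv, Real.norm_eq_abs, Real.norm_eq_abs, abs_of_pos hε',
        inv_mul_le_iff₀ hε']
      linarith
    · filter_upwards [h.ae_bounds, hv.2] with x ⟨h1, h2, h3, h4⟩ h5
      have d1 := hasDerivAt_reactionPrim (a := a) (γ := γ) (lam := lam) (t := v x)
        h.p_nonneg h2 h3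
      -- As v lies between `vlo` and `vhi`, the frozen reaction is the true one at v.
      rw [min_eq_left h5.2, max_eq_right h5.1] at d1
      have d2 : HasDerivAt (fun ε : ℝ => v x + ε * ψ x) (ψ x) 0 := by
        simpa using ((hasDerivAt_id (0 : ℝ)).mul_const (ψ x)).const_add (v x)
      have d3 : HasDerivAt (fun ε : ℝ => Φ x (v x + ε * ψ x))
          (reaction a γ p lam x (v x) * ψ x) 0 :=
        HasDerivAt.comp (h₂ := Φ x) 0 (by simpa using d1) d2
      simpa using d3.tendsto_slope_zero_right
  have hlim2 : Tendsto (fun ε : ℝ => (∫ x in Ω, inner ℝ (wgrad Ω v x) (wgrad Ω ψ x)) +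
      ε / 2 * ∫ x in Ω, ‖wgrad Ω ψ x‖ ^ 2) (𝓝[>] 0)
      (𝓝 (∫ x in Ω, inner ℝ (wgrad Ω v x) (wgrad Ω ψ x))) := by
    have : Continuous fun ε : ℝ => (∫ x in Ω, inner ℝ (wgrad Ω v x) (wgrad Ω ψ x)) +
      ε / 2 * ∫ x in Ω, ‖wgrad Ω ψ x‖ ^ 2 := by fun_prop
    simpa using (this.tendsto 0).mono_left nhdsWithin_le_nhds
  exact le_of_tendsto_of_tendsto hlim hlim2 (by
    filter_upwards [self_mem_nhdsWithin] with ε hε using hquot ε hε)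

/-- A minimiser of the truncated energy solves the problem. -/
theorem isSolution_of_isMinOn (h : IsOrderedPair Ω a γ p lam vlo vhi M)
    (hv : v ∈ between Ω vlo vhi)
    (hmin : IsMinOn (energy Ω (reactionPrim a γ p lam vlo vhi)) {z | MemH10 Ω z} v) :
    IsSolution Ω a γ p lam v := by
  have es : ∀ ψ : EuclideanSpace ℝ (Fin N) → ℝ,
      (fun x => a x * g (v x) ^ (-γ) * deriv g (v x) * ψ x) =
      fun x => a x * singNonlin γ (v x) * ψ x := fun ψ => by
    ext x
    rw [singNonlin]
    ring
  have is : ∀ ψ, MemH10 Ω ψ →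
      IntegrableOn (fun x => a x * g (v x) ^ (-γ) * deriv g (v x) * ψ x) Ω := fun ψ hψ => by
    rw [es]
    exact h.integrable_sing_of_between hv hψ
  have ip : ∀ ψ, MemH10 Ω ψ → IntegrableOn (fun x => g (v x) ^ p * deriv g (v x) * ψ x) Ω :=
    fun ψ hψ => h.integrable_pow_of_between hv hψ
  refine ⟨hv.1, ?_, ?_, is, ip, fun ψ hψ => ?_⟩
  · refine h.super.memLinfty.mono hv.1.memLp.1 ?_
    filter_upwards [h.ae_bounds, hv.2] with x ⟨h1, h2, h3, h4⟩ h5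
    rw [Real.norm_eq_abs, Real.norm_eq_abs, abs_of_pos (h2.trans_le h5.1),
      abs_of_pos (h2.trans_le h3)]
    exact h5.2
  · filter_upwards [h.ae_bounds, hv.2] with x ⟨h1, h2, h3, h4⟩ h5
    exact h2.trans_le h5.1
  · have e : ∫ x in Ω, reaction a γ p lam x (v x) * ψ x =
        (∫ x in Ω, a x * g (v x) ^ (-γ) * deriv g (v x) * ψ x) +
          lam * ∫ x in Ω, g (v x) ^ p * deriv g (v x) * ψ x := by
      rw [← integral_const_mul, ← integral_add (is ψ hψ) ((ip ψ hψ).const_mul lam)]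
      congr 1
      ext x
      simp only [reaction, singNonlin, powNonlin]
      ring
    rw [← e]
    refine le_antisymm ?_ (h.integral_reaction_le hv hmin hψ)
    -- The minimisation is over a linear space, so the direction -ψ is admissible and gives the
    -- reverse inequality.
    have pn := hψ.isH10Pair.const_mul (-1)
    have hn := h.integral_reaction_le hv hmin (pn.memH10 h.isOpen)
    have e2 : ∫ x in Ω, inner ℝ (wgrad Ω v x) (wgrad Ω (fun x => -1 * ψ x) x) =
        -∫ x in Ω, inner ℝ (wgrad Ω v x) (wgrad Ω ψ x) := by
      rw [← integral_neg]
      apply integral_congr_ae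
      filter_upwards [pn.wgrad_ae_eq h.isOpen] with x hx
      rw [hx, neg_one_smul, inner_neg_right]
    rw [e2] at hn
    simp only [neg_one_mul, mul_neg, integral_neg] at hn
    linarith

end IsOrderedPair

end SingQuasi

namespace SingQuasi

/-! ### Continuously differentiable functions vanishing on the boundary -/

open scoped Convolution

variable {N : ℕ} {Ω : Set (EuclideanSpace ℝ (Fin N))} {ψ φ : EuclideanSpace ℝ (Fin N) → ℝ}

/-- Mollification: a `C¹` function with compact support in `Ω` is uniformly close, together with
its gradient, to a test function. -/
theorem exists_isTestFunction_dist_le (hΩ : IsOpen Ω) (hψ : ContDiff ℝ 1 ψ)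
    (hc : HasCompactSupport ψ) (hs : tsupport ψ ⊆ Ω) {ε : ℝ} (hε : 0 < ε) :
    ∃ η, IsTestFunction Ω η ∧ ∀ x, ‖η x - ψ x‖ ≤ ε ∧ ‖∇ η x - ∇ ψ x‖ ≤ ε := by
  have hd : Continuous (fderiv ℝ ψ) := hψ.continuous_fderiv one_ne_zero
  obtain ⟨δ₀, hδ₀, hth⟩ := hc.isCompact.exists_cthickening_subset_open hΩ hs
  obtain ⟨δ₁, hδ₁, h1⟩ := Metric.uniformContinuous_iff.1
    (hc.uniformContinuous_of_continuous hψ.continuous) ε hε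
  obtain ⟨δ₂, hδ₂, h2⟩ := Metric.uniformContinuous_iff.1
    ((hc.fderiv ℝ).uniformContinuous_of_continuous hd) ε hε
  -- The radius keeps the mollified support in Ω and is within the moduli of uniform continuity of ψ
  -- and of its differential.
  set r := min δ₀ (min δ₁ δ₂) with hr
  have hr0 : 0 < r := by positivity
  let β : ContDiffBump (0 : EuclideanSpace ℝ (Fin N)) := ⟨r / 2, r, half_pos hr0, half_lt_self hr0⟩
  have hβr : β.rOut = r := rfl
  set η := β.normed volume ⋆[ContinuousLinearMap.lsmul ℝ ℝ, volume] ψ with hη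
  have hli : LocallyIntegrable (β.normed volume) :=
    β.continuous_normed.locallyIntegrable
  have hη1 : ∀ x, ‖η x - ψ x‖ ≤ ε := fun x => by
    rw [← dist_eq_norm]
    refine β.dist_normed_convolution_le hψ.continuous.aestronglyMeasurable fun y hy => ?_
    exact (h1 (lt_of_lt_of_le hy ((min_le_right _ _).trans (min_le_left _ _)))).le
  have hη2 : ∀ x, HasFDerivAt η
      ((β.normed volume ⋆[ContinuousLinearMap.lsmul ℝ ℝ, volume] fderiv ℝ ψ) x) x := fun x => by
    have := hc.hasFDerivAt_convolution_right (ContinuousLinearMap.lsmul ℝ ℝ) hli hψ x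
    exact this
  refine ⟨η, ⟨?_, ?_, ?_⟩, fun x => ⟨hη1 x, ?_⟩⟩
  · exact β.hasCompactSupport_normed.contDiff_convolution_left _ β.contDiff_normed
      hψ.continuous.locallyIntegrable
  · exact β.hasCompactSupport_normed.convolution _ hc
  · refine (closure_minimal ?_ Metric.isClosed_cthickening).trans hth
    refine (support_convolution_subset _).trans ?_
    rintro _ ⟨y, hy, z, hz, rfl⟩
    rw [β.support_normed_eq] at hy
    refine Metric.mem_cthickening_of_dist_le _ z δ₀ _ (subset_closure hz) ?_
    simp only [Metric.mem_ball, dist_zero_right] at hy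
    rw [dist_eq_norm, add_sub_cancel_right]
    exact hy.le.trans (min_le_left _ _)
  · simp only [gradient]
    rw [← map_sub, LinearIsometryEquiv.norm_map, (hη2 x).fderiv, ← dist_eq_norm]
    refine β.dist_normed_convolution_le hd.aestronglyMeasurable fun y hy => ?_
    exact (h2 (lt_of_lt_of_le hy ((min_le_right _ _).trans (min_le_right _ _)))).le

theorem isH10Pair_of_contDiff_one (hΩ : IsOpen Ω) [IsFiniteMeasure (volume.restrict Ω)]
    (hψ : ContDiff ℝ 1 ψ) (hc : HasCompactSupport ψ) (hs : tsupport ψ ⊆ Ω) :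
    IsH10Pair Ω ψ (∇ ψ) := by
  have hpos : ∀ n : ℕ, (0 : ℝ) < 1 / (n + 1) := fun n => by positivity
  have hlim := tendsto_one_div_add_atTop_nhds_zero_nat (𝕜 := ℝ)
  have hle1 : ∀ n : ℕ, (1 : ℝ) / (n + 1) ≤ 1 := fun n => by
    rw [div_le_one (by positivity)]
    linarith [n.cast_nonneg (α := ℝ)]
  choose η hη h using fun n : ℕ => exists_isTestFunction_dist_le hΩ hψ hc hs (hpos n)
  have m1 : MemLp ψ 2 (volume.restrict Ω) :=
    (hψ.continuous.memLp_of_hasCompactSupport hc).restrict Ω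
  have m2 : MemLp (∇ ψ) 2 (volume.restrict Ω) :=
    ((continuous_gradient hψ one_ne_zero).memLp_of_hasCompactSupport
      (hasCompactSupport_gradient hc)).restrict Ω
  refine isH10Pair_of_tendsto (fun n => isH10Pair_of_isTestFunction (hη n)) m1 m2 ?_ ?_
  · refine tendsto_eLpNorm_two_of_dominated (fun n => (memLp_of_isTestFunction (hη n)).1) m1.1
      (memLp_const 1) (fun n => Eventually.of_forall fun x => (h n x).1.trans (hle1 n))
      (Eventually.of_forall fun x => ?_)
    rw [tendsto_iff_norm_sub_tendsto_zero]
    exact squeeze_zero (fun _ => norm_nonneg _) (fun n => (h n x).1) hlim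
  · refine tendsto_eLpNorm_two_of_dominated
      (fun n => (memLp_gradient_of_isTestFunction (hη n)).1) m2.1
      (memLp_const 1) (fun n => Eventually.of_forall fun x => (h n x).2.trans (hle1 n))
      (Eventually.of_forall fun x => ?_)
    rw [tendsto_iff_norm_sub_tendsto_zero]
    exact squeeze_zero (fun _ => norm_nonneg _) (fun n => (h n x).2) hlim

/-- A continuous approximation of the indicator function of the positive reals, vanishing on
`t ≤ ε`. -/
noncomputable def ramp (ε t : ℝ) : ℝ := max 0 (min 1 (t / ε - 1))

/-- The primitive of `ramp ε`. -/
noncomputable def rampPrim (ε t : ℝ) : ℝ := ∫ s in (0 : ℝ)..t, ramp ε s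

section

variable {ε t : ℝ}

theorem continuous_ramp (ε : ℝ) : Continuous (ramp ε) := by
  unfold ramp
  fun_prop

theorem norm_ramp_le (ε t : ℝ) : ‖ramp ε t‖ ≤ 1 := by
  rw [Real.norm_eq_abs, abs_of_nonneg (le_max_left _ _)]
  exact max_le zero_le_one (min_le_left _ _)

theorem tendsto_ramp {ε : ℕ → ℝ} (hpos : ∀ n, 0 < ε n) (hε : Tendsto ε atTop (𝓝 0))
    (ht : 0 < t) : Tendsto (fun n => ramp (ε n) t) atTop (𝓝 1) := by
  refine tendsto_const_nhds.congr' ?_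
  filter_upwards [hε.eventually (gt_mem_nhds (half_pos ht))] with n hn
  have : 1 ≤ t / ε n - 1 := by
    rw [le_sub_iff_add_le, le_div_iff₀ (hpos n)]
    linarith
  rw [ramp, min_eq_left this, max_eq_right zero_le_one]

theorem hasDerivAt_rampPrim (ε t : ℝ) : HasDerivAt (rampPrim ε) (ramp ε t) t :=
  intervalIntegral.integral_hasDerivAt_right ((continuous_ramp ε).intervalIntegrable _ _)
    ((continuous_ramp ε).stronglyMeasurableAtFilter _ _) (continuous_ramp ε).continuousAt

theorem contDiff_rampPrim (ε : ℝ) : ContDiff ℝ 1 (rampPrim ε) := by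
  rw [contDiff_one_iff_deriv]
  refine ⟨fun t => (hasDerivAt_rampPrim ε t).differentiableAt, ?_⟩
  rw [funext fun t => (hasDerivAt_rampPrim ε t).deriv]
  exact continuous_ramp ε

theorem norm_rampPrim_le (ε t : ℝ) : ‖rampPrim ε t‖ ≤ |t| := by
  have := intervalIntegral.norm_integral_le_of_norm_le_const (a := 0) (b := t)
    (f := ramp ε) fun s _ => norm_ramp_le ε s
  rwa [sub_zero, one_mul] at this

theorem rampPrim_eq_zero (hε : 0 < ε) (ht0 : 0 ≤ t) (ht : t ≤ ε) : rampPrim ε t = 0 := by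
  rw [rampPrim, intervalIntegral.integral_congr (g := fun _ => 0)]
  · simp
  intro s hs
  rw [uIcc_of_le ht0] at hs
  have : s / ε - 1 ≤ 0 := by
    rw [sub_nonpos, div_le_one hε]
    exact hs.2.trans ht
  exact max_eq_left ((min_le_right _ _).trans this)

theorem tendsto_rampPrim {ε : ℕ → ℝ} (hpos : ∀ n, 0 < ε n) (hε : Tendsto ε atTop (𝓝 0))
    (ht : 0 ≤ t) : Tendsto (fun n => rampPrim (ε n) t) atTop (𝓝 t) := by
  have : Tendsto (fun n => rampPrim (ε n) t) atTop (𝓝 (∫ _ in (0 : ℝ)..t, (1 : ℝ))) := by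
    refine intervalIntegral.tendsto_integral_filter_of_dominated_convergence (fun _ => 1)
      (Eventually.of_forall fun n => (continuous_ramp _).aestronglyMeasurable)
      (Eventually.of_forall fun n => Eventually.of_forall fun s _ => norm_ramp_le _ s)
      (by simp) (Eventually.of_forall fun s hs => ?_)
    rw [uIoc_of_le ht] at hs
    exact tendsto_ramp hpos hε hs.1
  simpa using this

end

open Classical in
/-- A positive function in `C¹₀` can be cut off near the boundary. -/
theorem isH10Pair_rampPrim (hΩ : IsOpen Ω) (hb : Bornology.IsBounded Ω)
    [IsFiniteMeasure (volume.restrict Ω)] (hφ : MemC10 Ω φ) (hpos : ∀ x ∈ Ω, 0 < φ x)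
    {ε : ℝ} (hε : 0 < ε) :
    IsH10Pair Ω (fun x => rampPrim ε (φ x)) (fun x => ramp ε (φ x) • ∇ φ x) := by
  -- This superlevel set is compact and avoids the boundary, where φ = 0; it contains the support of
  -- the cut-off function.
  set C := closure Ω ∩ φ ⁻¹' Ici ε with hC
  have hCc : IsCompact C := hb.isCompact_closure.of_isClosed_subset
    (hφ.1.preimage_isClosed_of_isClosed isClosed_closure isClosed_Ici) inter_subset_left
  have hCΩ : C ⊆ Ω := by
    intro x hx
    by_contra hxΩ
    have hf : x ∈ frontier Ω := by
      rw [hΩ.frontier_eq]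
      exact ⟨hx.1, hxΩ⟩
    have h1 : ε ≤ φ x := hx.2
    rw [hφ.2.2.1 x hf] at h1
    linarith
  -- The values of φ outside the closure of Ω are arbitrary, hence the extension by zero.
  set ψ : EuclideanSpace ℝ (Fin N) → ℝ := fun x => if x ∈ Ω then rampPrim ε (φ x) else 0 with hψ
  have hψC : ∀ x, x ∉ C → ψ x = 0 := by
    intro x hx
    simp only [hψ]
    split_ifs with h
    · refine rampPrim_eq_zero hε (hpos x h).le ?_
      by_contra h2
      exact hx ⟨subset_closure h, (not_le.1 h2).le⟩
    · rfl
  have hψΩ : ∀ x ∈ Ω, ψ =ᶠ[𝓝 x] fun x => rampPrim ε (φ x) := by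
    intro x hx
    filter_upwards [hΩ.mem_nhds hx] with y hy
    simp only [hψ, if_pos hy]
  have hts : tsupport ψ ⊆ C := closure_minimal (fun x hx => by
    by_contra h
    exact hx (hψC x h)) hCc.isClosed
  have hψd : ContDiff ℝ 1 ψ := by
    rw [contDiff_iff_contDiffAt]
    intro x
    by_cases hx : x ∈ Ω
    · exact (((contDiff_rampPrim ε).contDiffAt).comp x
        (hφ.2.1.contDiffAt (hΩ.mem_nhds hx))).congr_of_eventuallyEq (hψΩ x hx)
    · refine (contDiffAt_const (c := (0 : ℝ))).congr_of_eventuallyEq ?_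
      filter_upwards [hCc.isClosed.isOpen_compl.mem_nhds fun h => hx (hCΩ h)] with y hy
      exact hψC y hy
  have hp := isH10Pair_of_contDiff_one hΩ hψd
    (hCc.of_isClosed_subset (isClosed_tsupport ψ) hts) (hts.trans hCΩ)
  refine hp.congr_ae ?_ ?_
  · filter_upwards [ae_restrict_mem hΩ.measurableSet] with x hx
    simp only [hψ, if_pos hx]
  · filter_upwards [ae_restrict_mem hΩ.measurableSet] with x hx
    have d1 : DifferentiableAt ℝ φ x :=
      (hφ.2.1.contDiffAt (hΩ.mem_nhds hx)).differentiableAt one_ne_zero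
    have d2 := (hasDerivAt_rampPrim ε (φ x)).comp_hasFDerivAt x d1.hasFDerivAt
    have d3 : fderiv ℝ ψ x = ramp ε (φ x) • fderiv ℝ φ x :=
      (d2.congr_of_eventuallyEq (hψΩ x hx)).fderiv
    simp only [gradient]
    rw [d3, map_smul]

/-- The cut-offs `rampPrim ε (φ x)` and their gradients are dominated by the bounds of φ and ∇φ on Ω
and converge pointwise as ε → 0. Membership in H¹₀ makes φ an admissible test function in the case γ
= 1. -/
theorem MemC10.memH10 (hΩ : IsOpen Ω) (hb : Bornology.IsBounded Ω)
    [IsFiniteMeasure (volume.restrict Ω)] (hφ : MemC10 Ω φ) (hpos : ∀ x ∈ Ω, 0 < φ x) :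
    MemH10 Ω φ := by
  have hn : ∀ n : ℕ, (0 : ℝ) < 1 / (n + 1) := fun n => by positivity
  have hlim := tendsto_one_div_add_atTop_nhds_zero_nat (𝕜 := ℝ)
  obtain ⟨F, hF, hFφ⟩ := hφ.2.2.2
  obtain ⟨B, hB⟩ := hb.isCompact_closure.exists_bound_of_continuousOn hφ.1
  obtain ⟨B', hB'⟩ := hb.isCompact_closure.exists_bound_of_continuousOn hF
  have hmem := ae_restrict_mem (μ := volume) hΩ.measurableSet
  have key : IsH10Pair Ω φ (∇ φ) := by
    refine isH10Pair_of_dominated (fun n : ℕ => isH10Pair_rampPrim hΩ hb hφ hpos (hn n))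
      (memLp_const B) (memLp_const B') (fun n => ?_) (fun n => ?_) ?_ ?_
    · filter_upwards [hmem] with x hx
      exact (norm_rampPrim_le _ _).trans (hB x (subset_closure hx))
    · filter_upwards [hmem] with x hx
      rw [norm_smul, ← hFφ x hx]
      exact (mul_le_of_le_one_left (norm_nonneg _) (norm_ramp_le _ _)).trans
        (hB' x (subset_closure hx))
    · filter_upwards [hmem] with x hx
      exact tendsto_rampPrim hn hlim (hpos x hx).le
    · filter_upwards [hmem] with x hx
      simpa using (tendsto_ramp hn hlim (hpos x hx)).smul_const (∇ φ x)
  exact key.memH10 hΩ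

end SingQuasi

namespace SingQuasi

/-! ### The singular energy -/

variable {N : ℕ} {Ω : Set (EuclideanSpace ℝ (Fin N))}
  {a : EuclideanSpace ℝ (Fin N) → ℝ} {γ p lam : ℝ}
  {vlo vhi u v z ψ : EuclideanSpace ℝ (Fin N) → ℝ} {M : ℝ}

/-- The integrand `a(x) G(|t|) + lam G̃(x, t)` of the singular energy. -/
noncomputable def singularPrim {N : ℕ} (a : EuclideanSpace ℝ (Fin N) → ℝ) (γ p lam : ℝ)
    (vlo vhi : EuclideanSpace ℝ (Fin N) → ℝ) (x : EuclideanSpace ℝ (Fin N)) (t : ℝ) : ℝ :=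
  a x * singPrim γ |t| + lam * truncPrim p (vlo x) (vhi x) t

namespace IsOrderedPair

/-- The pointwise bounds for G reduce the claim to the subsolution's integrability against `vlo`.
For γ = 1 two more terms occur: the subsolution's integrability against φ, and a φ⁻¹, which is in
L^q and hence in L¹ on a set of finite measure. -/
theorem integrable_singPrim_lo (h : IsOrderedPair Ω a γ p lam vlo vhi M)
    (hb : Bornology.IsBounded Ω) (hN : 1 ≤ N) (hH : CondH Ω a γ) :
    IntegrableOn (fun x => a x * singPrim γ (vlo x)) Ω := by
  have := h.finite
  have meas : AEStronglyMeasurable (fun x => a x * singPrim γ (vlo x)) (volume.restrict Ω) :=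
    (h.meas.mul ((measurable_singPrim γ).comp_aemeasurable h.measurable_lo)).aestronglyMeasurable
  have i1 := h.integrable_sing h.sub.memH10
  by_cases hγ : γ = 1
  · subst hγ
    obtain ⟨φ, q, hφ, hq, hφpos, hL⟩ := hH
    have i2 := h.integrable_sing (hφ.memH10 h.isOpen hb hφpos)
    have i3 := hL.integrable (by
      rw [ENNReal.one_le_ofReal]
      exact (by exact_mod_cast hN : (1 : ℝ) ≤ N).trans hq.le)
    refine ((((i1.const_mul (M / deriv g M)).add (i1.const_mul (1 / deriv g M ^ 2))).add
      (i2.const_mul (1 / deriv g M))).add i3).mono' meas ?_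
    filter_upwards [h.ae_bounds, ae_restrict_mem h.isOpen.measurableSet] with
      x ⟨h1, h2, h3, h4⟩ hx
    rw [norm_mul, Real.norm_eq_abs, Real.norm_eq_abs, abs_of_pos h1]
    refine (mul_le_mul_of_nonneg_left
      (abs_singPrim_one_le h.M_nonneg h2 (h3.trans h4) (hφpos x hx)) h1.le).trans (le_of_eq ?_)
    simp only [Pi.add_apply]
    ring
  · refine (i1.const_mul (1 / (deriv g M * |1 - γ|))).mono' meas ?_
    filter_upwards [h.ae_bounds] with x ⟨h1, h2, h3, h4⟩
    rw [norm_mul, Real.norm_eq_abs, Real.norm_eq_abs, abs_of_pos h1]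
    refine (mul_le_mul_of_nonneg_left
      (abs_singPrim_le_of_ne_one hγ h.M_nonneg h2 (h3.trans h4)) h1.le).trans (le_of_eq ?_)
    ring

theorem truncPrim_eq (h : IsOrderedPair Ω a γ p lam vlo vhi M) :
    ∀ᵐ x ∂volume.restrict Ω, ∀ t, truncPrim p (vlo x) (vhi x) t =
      clampPrim (powNonlin p) (vlo x) (vhi x) t - clampPrim (powNonlin p) (vlo x) (vhi x) 0 := by
  filter_upwards [h.le] with x hx t
  rw [← truncPrim_sub h.p_nonneg hx, show truncPrim p (vlo x) (vhi x) 0 = 0 from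
    intervalIntegral.integral_same, sub_zero]

theorem memH10_zero (hΩ : IsOpen Ω) : MemH10 Ω (fun _ => 0) :=
  (isH10Pair_of_isTestFunction isTestFunction_zero).memH10 hΩ

theorem integrable_truncPrim (h : IsOrderedPair Ω a γ p lam vlo vhi M) (hz : MemH10 Ω z) :
    IntegrableOn (fun x => truncPrim p (vlo x) (vhi x) (z x)) Ω :=
  ((h.integrable_pow_clampPrim hz).sub
    (h.integrable_pow_clampPrim (memH10_zero h.isOpen))).congr
    (h.truncPrim_eq.mono fun _ hx => (hx _).symm)

theorem integrable_singularPrim (h : IsOrderedPair Ω a γ p lam vlo vhi M)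
    (hz : z ∈ effDomain Ω a γ) :
    IntegrableOn (fun x => singularPrim a γ p lam vlo vhi x (z x)) Ω :=
  hz.2.2.add ((h.integrable_truncPrim hz.1).const_mul lam)

theorem truncEnergy_eq (h : IsOrderedPair Ω a γ p lam vlo vhi M) (hz : z ∈ effDomain Ω a γ) :
    truncEnergy Ω a γ p lam vlo vhi z = energy Ω (singularPrim a γ p lam vlo vhi) z := by
  unfold truncEnergy energy singularPrim
  rw [integral_add hz.2.2 ((h.integrable_truncPrim hz.1).const_mul lam), integral_const_mul]
  ring

theorem singPrim_eq_of_between (h : IsOrderedPair Ω a γ p lam vlo vhi M)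
    (hu : u ∈ between Ω vlo vhi) :
    ∀ᵐ x ∂volume.restrict Ω, a x * singPrim γ |u x| =
      a x * clampPrim (singNonlin γ) (vlo x) (vhi x) (u x) + a x * singPrim γ (vlo x) := by
  filter_upwards [h.ae_bounds, hu.2] with x ⟨h1, h2, h3, h4⟩ h5
  rw [clampPrim_eq_sub (H := singPrim γ) (fun s hs => hasDerivAt_singPrim (h2.trans_le hs.1))
    (continuousOn_singNonlin_Icc h2) h5.1 h5.2, abs_of_pos (h2.trans_le h5.1)]
  ring

theorem mem_effDomain_of_between (h : IsOrderedPair Ω a γ p lam vlo vhi M)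
    (hlo : IntegrableOn (fun x => a x * singPrim γ (vlo x)) Ω) (hu : u ∈ between Ω vlo vhi) :
    u ∈ effDomain Ω a γ := by
  refine ⟨hu.1, fun _ => ?_, ?_⟩
  · filter_upwards [h.ae_bounds, hu.2] with x ⟨h1, h2, h3, h4⟩ h5
    exact (h2.trans_le h5.1).ne'
  · exact ((h.integrable_sing_clampPrim hu.1).add hlo).congr
      ((h.singPrim_eq_of_between hu).mono fun _ hx => hx.symm)

/-- Between the subsolution and the supersolution, the singular energy and the truncated energy
differ by a constant. -/
theorem truncEnergy_eq_of_between (h : IsOrderedPair Ω a γ p lam vlo vhi M)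
    (hlo : IntegrableOn (fun x => a x * singPrim γ (vlo x)) Ω) (hu : u ∈ between Ω vlo vhi) :
    truncEnergy Ω a γ p lam vlo vhi u = energy Ω (reactionPrim a γ p lam vlo vhi) u -
      (∫ x in Ω, a x * singPrim γ (vlo x)) +
        lam * ∫ x in Ω, clampPrim (powNonlin p) (vlo x) (vhi x) 0 := by
  have e1 := integral_congr_ae (h.singPrim_eq_of_between hu)
  rw [integral_add (h.integrable_sing_clampPrim hu.1) hlo] at e1
  have e2 := integral_congr_ae (h.truncPrim_eq.mono fun x hx => hx (u x))
  rw [integral_sub (h.integrable_pow_clampPrim hu.1)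
    (h.integrable_pow_clampPrim (memH10_zero h.isOpen))] at e2
  have e3 : ∫ x in Ω, reactionPrim a γ p lam vlo vhi x (u x) =
      (∫ x in Ω, a x * clampPrim (singNonlin γ) (vlo x) (vhi x) (u x)) +
        lam * ∫ x in Ω, clampPrim (powNonlin p) (vlo x) (vhi x) (u x) := by
    rw [← integral_const_mul]
    exact integral_add (h.integrable_sing_clampPrim hu.1)
      ((h.integrable_pow_clampPrim hu.1).const_mul lam)
  rw [truncEnergy, energy, e1, e2, e3]
  ring

theorem abs_mem_effDomain (hΩ : IsOpen Ω) (hz : z ∈ effDomain Ω a γ) :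
    (fun x => |z x|) ∈ effDomain Ω a γ := by
  refine ⟨hz.1.isH10Pair.abs.memH10 hΩ, fun h1 => ?_, ?_⟩
  · exact (hz.2.1 h1).mono fun x hx => abs_ne_zero.2 hx
  · simp only [abs_abs]
    exact hz.2.2

/-- The frozen power term takes its values at points at least `lo ≥ 0`, so it is nonnegative and its
primitive is nondecreasing. -/
theorem truncPrim_le_truncPrim_abs {lo hi t : ℝ} (hp : 0 ≤ p) (hlo : 0 ≤ lo) (hle : lo ≤ hi) :
    truncPrim p lo hi t ≤ truncPrim p lo hi |t| := by
  rw [← sub_nonneg, truncPrim_sub hp hle,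
    clampPrim_sub (continuous_powNonlin hp).continuousOn hle]
  exact intervalIntegral.integral_nonneg (le_abs_self t) fun s _ =>
    powNonlin_nonneg (hlo.trans (le_max_left _ _))

/-- The gradient of |z| is no longer than that of z, the singular term sees only |z|, and the
truncated primitive does not decrease. This reduces the comparison to nonnegative competitors. -/
theorem energy_abs_le (h : IsOrderedPair Ω a γ p lam vlo vhi M) (hz : z ∈ effDomain Ω a γ) :
    energy Ω (singularPrim a γ p lam vlo vhi) (fun x => |z x|) ≤
      energy Ω (singularPrim a γ p lam vlo vhi) z := by
  have hp := hz.1.isH10Pair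
  rw [hp.abs.energy_eq h.isOpen, energy]
  have s1 : ∫ x in Ω, ‖(z x / |z x|) • wgrad Ω z x‖ ^ 2 ≤ ∫ x in Ω, ‖wgrad Ω z x‖ ^ 2 := by
    refine integral_mono (integrable_norm_sq hp.abs.memLp_grad)
      (integrable_norm_sq hp.memLp_grad) fun x => ?_
    have : ‖(z x / |z x|) • wgrad Ω z x‖ ≤ ‖wgrad Ω z x‖ := by
      rw [norm_smul, Real.norm_eq_abs, abs_div, abs_abs]
      exact mul_le_of_le_one_left (norm_nonneg _) (div_self_le_one _)
    simp only
    gcongr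
  have s2 : ∫ x in Ω, singularPrim a γ p lam vlo vhi x (z x) ≤
      ∫ x in Ω, singularPrim a γ p lam vlo vhi x |z x| := by
    refine integral_mono_ae (h.integrable_singularPrim hz)
      (h.integrable_singularPrim (abs_mem_effDomain h.isOpen hz)) ?_
    filter_upwards [h.ae_bounds] with x ⟨h1, h2, h3, h4⟩
    simp only [singularPrim, abs_abs]
    have := mul_le_mul_of_nonneg_left
      (truncPrim_le_truncPrim_abs (t := z x) h.p_nonneg h2.le h3) h.lam_nonneg
    linarith
  linarith

/-- For t outside [vlo x, vhi x], G lies below its tangent at the nearer endpoint by concavity,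
while the truncated power term is affine there and contributes equality. This is the hypothesis of
`energy_clamp_le`, now for the untruncated singular term. -/
theorem singularPrim_sub_clamp_le {x : EuclideanSpace ℝ (Fin N)} {t : ℝ} (hγ : 0 < γ)
    (hp : 0 ≤ p) (ha : 0 ≤ a x) (hlo : 0 < vlo x) (hle : vlo x ≤ vhi x) (ht : 0 ≤ t)
    (ht' : 1 ≤ γ → t ≠ 0) :
    singularPrim a γ p lam vlo vhi x t -
        singularPrim a γ p lam vlo vhi x (max (vlo x) (min t (vhi x))) ≤
      reaction a γ p lam x (vhi x) * max (t - vhi x) 0 -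
        reaction a γ p lam x (vlo x) * max (vlo x - t) 0 := by
  have h1 := clampPrim_sub_clamp (t := t) (continuous_powNonlin hp).continuousOn hle
  rw [← truncPrim_sub hp hle] at h1
  have h2 : singPrim γ t - singPrim γ (max (vlo x) (min t (vhi x))) ≤
      singNonlin γ (vhi x) * max (t - vhi x) 0 - singNonlin γ (vlo x) * max (vlo x - t) 0 := by
    rcases le_total t (vlo x) with c1 | c1
    · rw [min_eq_left (c1.trans hle), max_eq_left c1, max_eq_right (by linarith),
        max_eq_left (by linarith)]
      have := singPrim_sub_le hγ hlo ht ht'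
      linarith
    rcases le_total t (vhi x) with c2 | c2
    · rw [min_eq_left c2, max_eq_right c1, max_eq_right (by linarith),
        max_eq_right (by linarith)]
      simp
    · rw [min_eq_right c2, max_eq_right hle, max_eq_left (by linarith),
        max_eq_right (by linarith)]
      have := singPrim_sub_le hγ (hlo.trans_le hle) ht ht'
      linarith
  have h3 := mul_le_mul_of_nonneg_left h2 ha
  simp only [singularPrim, reaction, abs_of_nonneg ht,
    abs_of_pos (hlo.trans_le (le_max_left (vlo x) (min t (vhi x))))]
  linear_combination h3 + lam * h1

/-- A minimiser of the truncated energy minimises the singular energy. -/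
theorem isMinOn_truncEnergy (h : IsOrderedPair Ω a γ p lam vlo vhi M)
    (hlo : IntegrableOn (fun x => a x * singPrim γ (vlo x)) Ω) (hv : v ∈ between Ω vlo vhi)
    (hmin : IsMinOn (energy Ω (reactionPrim a γ p lam vlo vhi)) {z | MemH10 Ω z} v) :
    IsMinOn (truncEnergy Ω a γ p lam vlo vhi) (effDomain Ω a γ) v := by
  refine isMinOn_iff.2 fun z hz => ?_
  have hz' := abs_mem_effDomain h.isOpen hz
  have hw := h.clamp_mem_between hz'.1
  have hwD := h.mem_effDomain_of_between hlo hw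
  calc truncEnergy Ω a γ p lam vlo vhi v
      ≤ truncEnergy Ω a γ p lam vlo vhi (fun x => max (vlo x) (min |z x| (vhi x))) := by
        -- Both functions lie in the order interval, where the two energies differ by the same
        -- constant.
        rw [h.truncEnergy_eq_of_between hlo hv, h.truncEnergy_eq_of_between hlo hw]
        have := isMinOn_iff.1 hmin _ hw.1
        linarith
    _ = energy Ω (singularPrim a γ p lam vlo vhi) _ := h.truncEnergy_eq hwD
    _ ≤ energy Ω (singularPrim a γ p lam vlo vhi) (fun x => |z x|) := by
        refine h.energy_clamp_le hz'.1 (h.integrable_singularPrim hz')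
          (h.integrable_singularPrim hwD) ?_
        by_cases hγ1 : 1 ≤ γ
        · filter_upwards [h.ae_bounds, hz'.2.1 hγ1] with x ⟨h1, h2, h3, h4⟩ h5
          exact singularPrim_sub_clamp_le h.gamma_pos h.p_nonneg h1.le h2 h3 (abs_nonneg _)
            fun _ => h5
        · filter_upwards [h.ae_bounds] with x ⟨h1, h2, h3, h4⟩
          exact singularPrim_sub_clamp_le h.gamma_pos h.p_nonneg h1.le h2 h3 (abs_nonneg _)
            fun hc => absurd hc hγ1
    _ ≤ energy Ω (singularPrim a γ p lam vlo vhi) z := h.energy_abs_le hz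
    _ = truncEnergy Ω a γ p lam vlo vhi z := (h.truncEnergy_eq hz).symm

end IsOrderedPair

end SingQuasi

/-! ### Existence and minimality of the solution. -/

theorem theorem2p1 (N : ℕ) (hN : 3 ≤ N) (Ω : Set (EuclideanSpace ℝ (Fin N)))
    (hΩ : SingQuasi.IsBoundedSmoothDomain Ω)
    (a : EuclideanSpace ℝ (Fin N) → ℝ) (ha : AEMeasurable a (volume.restrict Ω))
    (ha_pos : ∀ᵐ x ∂(volume.restrict Ω), 0 < a x)
    (γ p lam : ℝ) (hγ : 0 < γ) (hp : 3 ≤ p) (hlam : 0 ≤ lam)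
    (vlo vhi : EuclideanSpace ℝ (Fin N) → ℝ)
    (hlo : SingQuasi.IsSubsolution Ω a γ p lam vlo)
    (hhi : SingQuasi.IsSupersolution Ω a γ p lam vhi)
    (hle : ∀ᵐ x ∂(volume.restrict Ω), vlo x ≤ vhi x) :
    ∃ v : EuclideanSpace ℝ (Fin N) → ℝ,
      SingQuasi.IsSolution Ω a γ p lam v ∧
      (∀ᵐ x ∂(volume.restrict Ω), vlo x ≤ v x ∧ v x ≤ vhi x) ∧
      (SingQuasi.CondH Ω a γ →
        v ∈ SingQuasi.effDomain Ω a γ ∧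
        IsMinOn (SingQuasi.truncEnergy Ω a γ p lam vlo vhi) (SingQuasi.effDomain Ω a γ) v) := by
  have hfin : IsFiniteMeasure (volume.restrict Ω) :=
    isFiniteMeasure_restrict.2 hΩ.isBounded.measure_lt_top.ne
  -- The bound M is the essential supremum of |vhi|, finite because supersolutions are bounded.
  have h : SingQuasi.IsOrderedPair Ω a γ p lam vlo vhi
      (eLpNormEssSup vhi (volume.restrict Ω)).toReal := by
    refine ⟨hΩ.isOpen, hfin, ha, ha_pos, hγ, by linarith, hlam, hlo, hhi, hle,
      ENNReal.toReal_nonneg, ?_⟩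
    have hne : eLpNormEssSup vhi (volume.restrict Ω) ≠ ⊤ := by
      have := hhi.memLinfty.2.ne
      rwa [eLpNorm_exponent_top] at this
    filter_upwards [ae_le_eLpNormEssSup (f := vhi) (μ := volume.restrict Ω)] with x hx
    have := ENNReal.toReal_mono hne hx
    rw [toReal_enorm] at this
    exact (le_abs_self _).trans this
  obtain ⟨v, hv, hmin⟩ := h.exists_isMinOn
  refine ⟨v, h.isSolution_of_isMinOn hv hmin, hv.2, fun hH => ?_⟩
  have hint := h.integrable_singPrim_lo hΩ.isBounded (by omega) hH
  exact ⟨h.mem_effDomain_of_between hint hv, h.isMinOn_truncEnergy hint hv hmin⟩
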